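/- Notation. Let ${}^*$ denote a nonstandard extension (an ultrapower by an arbitrary ultrafilter). For $\eta\in{}^*\mathbb{N}\setminus\mathbb{N}$ let $\overline{\mathcal T}_\eta=\{t\in{}^*\mathbb{R}:0\le t<\eta\}$ and $\overline{\mathcal R}_\eta=\{x\in{}^*\mathbb{R}:-\eta\le x<\eta\}$, each cut into the cells $[\frac j\eta,\frac{j+1}\eta)$, $j\in{}^*\mathbb{Z}$; a function on $\overline{\mathcal T}_\eta\times\overline{\mathcal R}_\eta$ or $\overline{\mathcal R}_\eta$ is measurable if it is internal and measurable for the algebra of internal unions of (products of) cells. Let $\lambda_\eta$ be the measure on $\overline{\mathcal R}_\eta$ giving each cell mass $\frac1\eta$, so that $\int\varphi\,d\lambda_\eta=\frac1\eta\,{}^*\!\sum_{-\eta^2\le j<\eta^2}\varphi(\frac j\eta)$. For measurable $f,a,b:\overline{\mathcal T}_\eta\times\overline{\mathcal R}_\eta\to{}^*\mathbb{C}$ let $\frac{\partial f}{\partial t}$ be the measurable function with $\frac{\partial f}{\partial t}(\frac j\eta,x)=\eta\big(f(\frac{j+1}\eta,x)-f(\frac j\eta,x)\big)$ for $0\le j\le\eta^2-2$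 and $\frac{\partial f}{\partial t}(\frac{\eta^2-1}\eta,x)=0$; let $\frac{\partial f}{\partial x}$ be the measurable function with $\frac{\partial f}{\partial x}(t,\frac j\eta)=\eta\big(f(t,\frac{j+1}\eta)-f(t,\frac j\eta)\big)$ for $-\eta^2\le j\le\eta^2-2$ and $\frac{\partial f}{\partial x}(t,\frac{\eta^2-1}\eta)=0$; and put $$\check f(t,y)=\int f(t,x)\,{}^*\!\exp\Big(\pi i\tfrac{[\eta x]}\eta\tfrac{[\eta y]}\eta\Big)d\lambda_\eta(x),\qquad (a*b)(t,x)=\int a\big(t,\tfrac{[\eta x]}\eta-y\big)\,b(t,y)\,d\lambda_\eta(y),$$ where differences are taken modulo $2\eta$. For $\omega'\in{}^*\mathbb{N}\setminus\mathbb{N}$ with $\omega'<\eta$ let $F_{\omega'}$ be the measurable function on $\overline{\mathcal T}_\eta\times\overline{\mathcal R}_\eta$ with $F_{\omega'}(t,\frac j\eta)=\frac12$ if $-\omega'\eta\le j\le\omega'\eta$ and $0$ otherwise. Let $st$ be the standard part map from ${}^*\mathbb{R}$ to $[-\infty,+\infty]$, applied to each coordinate of $(t,x)$, let $st^*(\Phi)=\Phi\circ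 st$, and let ${}^\circ z$ be the standard part of a finite $z\in{}^*\mathbb{C}$. Theorem. Let $g:\mathbb{R}\to\mathbb{C}$ be continuous with $|g(x)|\le A\exp(B|x|^\rho)$ for all $x\in\mathbb{R}$, for some constants $A,B$ and $\rho<2$. Let $$H(0,x)=g(x),\qquad H(t,x)=\frac1{\sqrt{4\pi t}}\int_{\mathbb{R}}\exp\Big(\frac{-(x-y)^2}{4t}\Big)g(y)\,dy\quad(t>0)$$ be the classical solution of the heat equation on $[0,\infty)\times\mathbb{R}$ with boundary condition $g$, and let $H_\infty$ be its extension to $[0,+\infty]\times[-\infty,+\infty]$ by the value $0$ at all points with an infinite coordinate. Let $\eta,\omega,\omega'\in{}^*\mathbb{N}\setminus\mathbb{N}$ be such that $\eta-\omega$ is (positive) infinite, $\omega<\omega'^{1/2}$ and $\omega'<\log(\eta)^{1/2}$. Let $g_{\eta,\omega}(x)={}^*g(\frac{[\eta x]}\eta)\,\chi_{[-\omega,\omega)}(x)$ for $x\in\overline{\mathcal R}_\eta$, and let $f:\overline{\mathcal T}_\eta\times\overline{\mathcal R}_\eta\to{}^*\mathbb{C}$ be the measurable function with $$\frac{\partial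 f}{\partial t}-\frac{\partial^2f}{\partial x^2}=0\ \text{ on }\ \Big(\overline{\mathcal T}_\eta\setminus\big[\tfrac{\eta^2-1}\eta,\eta\big)\Big)\times\overline{\mathcal R}_\eta,\qquad f(0,x)=g_{\eta,\omega}(x)\ \text{ for } x\in\overline{\mathcal R}_\eta.$$ Then $${}^\circ(\check F_{\omega'}*f)\big|_{st^{-1}(\mathbb{R}_{>0}\times\mathbb{R})}=st^*(H_\infty),$$ that is, for all $t\in\overline{\mathcal T}_\eta$ finite with ${}^\circ t>0$ and all finite $x\in\overline{\mathcal R}_\eta$, the value $(\check F_{\omega'}*f)(t,x)$ is finite and ${}^\circ\big((\check F_{\omega'}*f)(t,x)\big)=H({}^\circ t,{}^\circ x)$. -/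

import Mathlib

open Filter Topology

namespace NSHeat

noncomputable section

/-! ### The nonstandard extension

For an arbitrary ultrafilter `𝒰` on an arbitrary index type, `Ext 𝒰 X` is the ultrapower `*X`.
The case of Mathlib's `ℝ*` is `𝒰 = hyperfilter ℕ`. Elements of `Ext 𝒰 (X → Y)` are the internal
functions `*X → *Y`. -/

/-- The nonstandard extension `*X`. -/
abbrev Ext {ι : Type*} (𝒰 : Ultrafilter ι) (X : Type*) : Type _ := Germ (𝒰 : Filter ι) X

variable {ι : Type*} {𝒰 : Ultrafilter ι}

/-- The inclusion `*ℕ ⊆ *ℝ`. -/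
def toReal (n : Ext 𝒰 ℕ) : Ext 𝒰 ℝ := Germ.map (fun k : ℕ => (k : ℝ)) n

/-- `*ℕ \ ℕ`, the nonstandard (equivalently, infinite) hypernatural numbers. -/
def infiniteNat (𝒰 : Ultrafilter ι) : Set (Ext 𝒰 ℕ) :=
  {n | ∀ k : ℕ, n ≠ ((k : ℕ) : Germ (𝒰 : Filter ι) ℕ)}

/-- The value of an internal function of one variable. -/
def app {X Y : Type*} (φ : Ext 𝒰 (X → Y)) (x : Ext 𝒰 X) : Ext 𝒰 Y :=
  Germ.map₂ (fun u a => u a) φ x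

/-- The value of an internal function of two variables. -/
def app₂ {X Y Z : Type*} (φ : Ext 𝒰 (X → Y → Z)) (x : Ext 𝒰 X) (y : Ext 𝒰 Y) : Ext 𝒰 Z :=
  app (app φ x) y

/-- The time domain `{τ ∈ *ℝ : 0 ≤ τ < η}`. -/
def timeDomain (η : Ext 𝒰 ℕ) : Set (Ext 𝒰 ℝ) := {t | 0 ≤ t ∧ t < toReal η}

/-- The space domain `{x ∈ *ℝ : -η ≤ x < η}`. -/
def spaceDomain (η : Ext 𝒰 ℕ) : Set (Ext 𝒰 ℝ) := {x | -toReal η ≤ x ∧ x < toReal η}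

/-- The standard part map `*ℝ → [-∞, +∞]`: infinite elements go to `±∞`, and a finite element goes
to the real number infinitely close to it. -/
def st (x : Ext 𝒰 ℝ) : EReal :=
  ⨆ r : {r : ℝ // (r : Germ (𝒰 : Filter ι) ℝ) ≤ x}, ((r : ℝ) : EReal)

/-- `z ∈ *ℂ` is finite and its standard part is `c`: `z` lies in `*U` for every standard
neighbourhood `U` of `c`. -/
def HasStdPart (z : Ext 𝒰 ℂ) (c : ℂ) : Prop := Germ.Tendsto z (𝓝 c)

/-! ### The discrete objects at a standard natural number `n`

They live on `[0, n) × [-n, n)`, cut into cells of side `1 / n`; values of functions outside of this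
domain are never used. -/

/-- The algebra on a set `s ⊆ ℝ` generated by the cells `[j / n, (j + 1) / n)`, `j ∈ ℤ`. -/
@[reducible] def cellAlgebra (n : ℕ) (s : Set ℝ) : MeasurableSpace s :=
  MeasurableSpace.generateFrom
    {C | ∃ j : ℤ, C = {x : s | (j : ℝ) / n ≤ (x : ℝ) ∧ (x : ℝ) < ((j : ℝ) + 1) / n}}

/-- Measurability of `f` on `[0, n) × [-n, n)` for the product of the two cell algebras. -/
def IsDiscreteMeasurable (n : ℕ) (f : ℝ → ℝ → ℂ) : Prop :=
  @Measurable _ _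
    ((cellAlgebra n (Set.Ico 0 (n : ℝ))).prod (cellAlgebra n (Set.Ico (-(n : ℝ)) n))) _
    (fun p : Set.Ico 0 (n : ℝ) × Set.Ico (-(n : ℝ)) n => f p.1 p.2)

/-- The integral over `[-n, n)`, against the measure giving mass `1 / n` to each cell, of the
measurable counterpart of `φ`, that is, of the function equal to `φ (j / n)` on
`[j / n, (j + 1) / n)`. -/
def discreteIntegral (n : ℕ) (φ : ℝ → ℂ) : ℂ :=
  (1 / (n : ℂ)) * ∑ j ∈ Finset.Ico (-((n : ℤ) ^ 2)) ((n : ℤ) ^ 2), φ ((j : ℝ) / n)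

/-- Forward difference quotient in time, `0` in the last time cell. -/
def discreteDt (n : ℕ) (f : ℝ → ℝ → ℂ) (t x : ℝ) : ℂ :=
  if ⌊(n : ℝ) * t⌋ ≤ (n : ℤ) ^ 2 - 2 then
    (n : ℂ) * (f (((⌊(n : ℝ) * t⌋ : ℝ) + 1) / n) x - f ((⌊(n : ℝ) * t⌋ : ℝ) / n) x)
  else 0

/-- Forward difference quotient in space, `0` in the last space cell. -/
def discreteDx (n : ℕ) (f : ℝ → ℝ → ℂ) (t x : ℝ) : ℂ :=
  if ⌊(n : ℝ) * x⌋ ≤ (n : ℤ) ^ 2 - 2 then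
    (n : ℂ) * (f t (((⌊(n : ℝ) * x⌋ : ℝ) + 1) / n) - f t ((⌊(n : ℝ) * x⌋ : ℝ) / n))
  else 0

/-- Inverse Fourier transform in space,
`f̌(t, y) = ∫ f(t, x) exp(π i [n x]/n · [n y]/n) dx`. -/
def discreteInvFourier (n : ℕ) (f : ℝ → ℝ → ℂ) (t y : ℝ) : ℂ :=
  discreteIntegral n fun x =>
    f t x * Complex.exp (Real.pi * Complex.I * (((⌊(n : ℝ) * x⌋ : ℝ) / n : ℝ) : ℂ) *
      (((⌊(n : ℝ) * y⌋ : ℝ) / n : ℝ) : ℂ))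

/-- The representative in `[-n, n)` of `x` modulo `2 n`. -/
def wrap (n : ℕ) (x : ℝ) : ℝ := x - 2 * n * (⌊(x + n) / (2 * n)⌋ : ℝ)

/-- Convolution in space, `(a * b)(t, x) = ∫ a(t, [n x]/n - y) b(t, y) dy`, the difference being
taken modulo `2 n`. -/
def discreteConv (n : ℕ) (a b : ℝ → ℝ → ℂ) (t x : ℝ) : ℂ :=
  discreteIntegral n fun y => a t (wrap n ((⌊(n : ℝ) * x⌋ : ℝ) / n - y)) * b t y

/-- The frequency cut-off, equal to `1 / 2` on the cells `[j / n, (j + 1) / n)` with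
`-w n ≤ j ≤ w n`, and to `0` on the other ones. -/
def discreteCutoff (n w : ℕ) (_t x : ℝ) : ℂ :=
  if -((w : ℤ) * n) ≤ ⌊(n : ℝ) * x⌋ ∧ ⌊(n : ℝ) * x⌋ ≤ (w : ℤ) * n then 1 / 2 else 0

/-- The product of the step function `x ↦ g ([n x]/n)` with the indicator of `[-w, w)`. -/
def discreteTruncation (g : ℝ → ℂ) (n w : ℕ) (x : ℝ) : ℂ :=
  if -(w : ℝ) ≤ x ∧ x < w then g ((⌊(n : ℝ) * x⌋ : ℝ) / n) else 0

/-! ### Their transfers at a hypernatural number `η` -/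

/-- `f` restricts to a measurable function on `timeDomain η × spaceDomain η`, for the hyperfinite
algebra generated by the cells of side `1 / η`. -/
def IsMeasurable (η : Ext 𝒰 ℕ) (f : Ext 𝒰 (ℝ → ℝ → ℂ)) : Prop :=
  Germ.LiftRel IsDiscreteMeasurable η f

/-- `∂f/∂t`. -/
def dt (η : Ext 𝒰 ℕ) (f : Ext 𝒰 (ℝ → ℝ → ℂ)) : Ext 𝒰 (ℝ → ℝ → ℂ) := Germ.map₂ discreteDt η f

/-- `∂f/∂x`. -/
def dx (η : Ext 𝒰 ℕ) (f : Ext 𝒰 (ℝ → ℝ → ℂ)) : Ext 𝒰 (ℝ → ℝ → ℂ) := Germ.map₂ discreteDx η f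

/-- The nonstandard inverse Fourier transform in space. -/
def invFourier (η : Ext 𝒰 ℕ) (f : Ext 𝒰 (ℝ → ℝ → ℂ)) : Ext 𝒰 (ℝ → ℝ → ℂ) :=
  Germ.map₂ discreteInvFourier η f

/-- The nonstandard convolution `a * b` in space. -/
def conv (η : Ext 𝒰 ℕ) (a b : Ext 𝒰 (ℝ → ℝ → ℂ)) : Ext 𝒰 (ℝ → ℝ → ℂ) :=
  Germ.map₂ (fun u v => u v) (Germ.map₂ discreteConv η a) b

/-- The nonstandard frequency cut-off `F_{ω'}`. -/
def cutoff (η ω' : Ext 𝒰 ℕ) : Ext 𝒰 (ℝ → ℝ → ℂ) := Germ.map₂ discreteCutoff η ω'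

/-- `g_{η,ω}`: the measurable extension of `g` to `spaceDomain η`, truncated to `[-ω, ω)`. -/
def truncation (g : ℝ → ℂ) (η ω : Ext 𝒰 ℕ) : Ext 𝒰 (ℝ → ℂ) :=
  Germ.map₂ (discreteTruncation g) η ω

/-- `f` is the nonstandard solution of `∂f/∂t - ∂²f/∂x² = 0` with boundary condition `b`. -/
structure IsHeatSolution (η : Ext 𝒰 ℕ) (b : Ext 𝒰 (ℝ → ℂ)) (f : Ext 𝒰 (ℝ → ℝ → ℂ)) : Prop where
  measurable : IsMeasurable η f
  heat_eq : ∀ t ∈ timeDomain η, t < (toReal η ^ 2 - 1) / toReal η → ∀ x ∈ spaceDomain η,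
    app₂ (dt η f) t x - app₂ (dx η (dx η f)) t x = 0
  boundary : ∀ x ∈ spaceDomain η, app₂ f 0 x = app b x

/-! ### The classical solution -/

/-- The classical solution `H` of the heat equation with boundary condition `g`. -/
def classicalSolution (g : ℝ → ℂ) (t x : ℝ) : ℂ :=
  if t = 0 then g x
  else ((1 / Real.sqrt (4 * Real.pi * t) : ℝ) : ℂ) *
    ∫ y : ℝ, ((Real.exp (-(x - y) ^ 2 / (4 * t)) : ℝ) : ℂ) * g y

open Classical in
/-- The extension `H_∞` of `H` by `0` at the points with an infinite coordinate. -/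
def extendedSolution (g : ℝ → ℂ) (t x : EReal) : ℂ :=
  if t = ⊤ ∨ t = ⊥ ∨ x = ⊤ ∨ x = ⊥ then 0 else classicalSolution g t.toReal x.toReal

end

end NSHeat

namespace NSHeat

/-! On the grid the equation is an explicit scheme: one time step applies `1 + n (S - 1) ^ 2`, with
`S` the shift by one cell. Both steps equal `1 / n`, so the scheme is unstable: the Fourier mode of
frequency `ξ` is multiplied at each step by `multiplier n ξ = 1 + n (exp (π i ξ / n) - 1) ^ 2`,
which is `1 + 4 n` at `ξ = n`. Convolution with the inverse transform of the cut-off removes the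
frequencies beyond `w`, and on the remaining ones the multiplier is `exp (-π ^ 2 ξ ^ 2 / n)` up to
`O(w ^ 4 / n ^ 2)` (`norm_multiplier_sub_exp_le`).

Forward differences carry information to the left only, two cells per step. As `n - ω` is infinite
and `t` finite, the evolved data neither meet the ends of the window nor wrap around, so the Fourier
computation is exact. The smoothed solution is thus the initial data summed against `discreteKernel`
(`discreteConv_heatSolution`).

This kernel is a Riemann sum for the truncated Fourier integral of the Gaussian, and differs from
the heat kernel by at most `P w ^ 5 / n + D exp (-a w ^ 2)` (`exists_norm_discreteKernel_sub_le`).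
On `[-ω, ω)` the data are at most `C exp (ω ^ 2) ≤ C exp w`, and `1 / n ≤ exp (-w ^ 2)`, so the
total error tends to `0` (`tendsto_sum_discreteKernel`). Dominated convergence
(`tendsto_riemannSum_heatKernel`) identifies the limit of the sums with the true heat kernel. -/

/-! ### The difference equation as a scheme on the integer lattice -/

/-- The explicit scheme `u_{k+1}(j) = u_k(j) + n (u_k(j+2) - 2 u_k(j+1) + u_k(j))` on the full
lattice `ℤ`. -/
def explicitScheme (n : ℕ) (u : ℤ → ℂ) : ℕ → ℤ → ℂ
  | 0 => u
  | k + 1 => fun j => explicitScheme n u k j + n * (explicitScheme n u k (j + 2) -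
      2 * explicitScheme n u k (j + 1) + explicitScheme n u k j)

lemma explicitScheme_succ (n : ℕ) (u : ℤ → ℂ) (k : ℕ) (j : ℤ) :
    explicitScheme n u (k + 1) j = explicitScheme n u k j + n * (explicitScheme n u k (j + 2) -
      2 * explicitScheme n u k (j + 1) + explicitScheme n u k j) := rfl

lemma explicitScheme_eq_zero_of_le {n : ℕ} {u : ℤ → ℂ} {M : ℤ} (hu : ∀ j, M ≤ j → u j = 0)
    (k : ℕ) : ∀ j, M ≤ j → explicitScheme n u k j = 0 := by
  induction k with
  | zero => exact hu
  | succ k ih =>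
    intro j hj
    rw [explicitScheme_succ, ih j hj, ih (j + 1) (by omega), ih (j + 2) (by omega)]
    simp

lemma explicitScheme_eq_zero_of_lt {n : ℕ} {u : ℤ → ℂ} {m : ℤ} (hu : ∀ j, j < m → u j = 0)
    (k : ℕ) : ∀ j, j < m - 2 * k → explicitScheme n u k j = 0 := by
  induction k with
  | zero => intro j hj; exact hu j (by simpa using hj)
  | succ k ih =>
    intro j hj
    push_cast at hj
    rw [explicitScheme_succ, ih j (by omega), ih (j + 1) (by omega), ih (j + 2) (by omega)]
    simp

lemma hasSum_shift_mul_exp {v : ℤ → ℂ} {c S : ℂ}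
    (h : HasSum (fun j : ℤ => v j * Complex.exp (c * j)) S) :
    HasSum (fun j : ℤ => v (j + 1) * Complex.exp (c * j)) (Complex.exp (-c) * S) := by
  have h1 := ((Equiv.addRight (1 : ℤ)).hasSum_iff.mpr h).mul_left (Complex.exp (-c))
  refine h1.congr_fun ?_ |> fun h => h
  intro j
  simp only [Function.comp, Equiv.coe_addRight]
  rw [mul_left_comm, ← Complex.exp_add]
  push_cast
  congr 2
  ring

/-- A shift of the sequence multiplies its Fourier series by `exp (-c)`, so a step of the scheme
multiplies it by `1 + n (exp (-c) - 1) ^ 2`. -/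
lemma hasSum_explicitScheme {n : ℕ} {u : ℤ → ℂ} {c S : ℂ}
    (h : HasSum (fun j : ℤ => u j * Complex.exp (c * j)) S) (k : ℕ) :
    HasSum (fun j : ℤ => explicitScheme n u k j * Complex.exp (c * j))
      ((1 + n * (Complex.exp (-c) - 1) ^ 2) ^ k * S) := by
  induction k with
  | zero => simpa [explicitScheme] using h
  | succ k ih =>
    have h1 := hasSum_shift_mul_exp ih
    have h2 := hasSum_shift_mul_exp (v := fun j => explicitScheme n u k (j + 1)) h1
    have h3 := ih.add (((h2.sub (h1.mul_left 2)).add ih).mul_left (n : ℂ))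
    convert h3 using 1
    · funext j
      rw [explicitScheme_succ, add_assoc j 1 1]
      norm_num
      ring
    · ring

lemma floor_mul_div {n : ℕ} (hn : n ≠ 0) (j : ℤ) : ⌊(n : ℝ) * ((j : ℝ) / n)⌋ = j := by
  rw [mul_div_cancel₀ _ (Nat.cast_ne_zero.mpr hn), Int.floor_intCast]

lemma discreteDt_grid {n : ℕ} (hn : n ≠ 0) (f : ℝ → ℝ → ℂ) {k : ℕ} (hk : (k : ℤ) ≤ (n : ℤ) ^ 2 - 2)
    (x : ℝ) : discreteDt n f ((k : ℝ) / n) x =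
      n * (f (((k + 1 : ℕ) : ℝ) / n) x - f ((k : ℝ) / n) x) := by
  have := floor_mul_div hn (k : ℤ)
  simp only [Int.cast_natCast] at this
  simp [discreteDt, this, hk]

lemma discreteDx_grid {n : ℕ} (hn : n ≠ 0) (f : ℝ → ℝ → ℂ) (t : ℝ) (j : ℤ) :
    discreteDx n f t ((j : ℝ) / n) = if j ≤ (n : ℤ) ^ 2 - 2 then
      n * (f t (((j + 1 : ℤ) : ℝ) / n) - f t ((j : ℝ) / n)) else 0 := by
  simp [discreteDx, floor_mul_div hn j]

/-- On the grid, a solution of the discrete heat equation is the explicit scheme on `ℤ`: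
information only travels to the left, and the data vanish in the last cell. -/
lemma heatSolution_grid {n : ℕ} (hn : n ≠ 0) {f : ℝ → ℝ → ℂ} {u : ℤ → ℂ} {M : ℤ}
    (heat : ∀ k : ℕ, (k : ℤ) ≤ (n : ℤ) ^ 2 - 2 → ∀ j : ℤ, -(n : ℤ) ^ 2 ≤ j → j < (n : ℤ) ^ 2 →
      discreteDt n f ((k : ℝ) / n) ((j : ℝ) / n) -
        discreteDx n (discreteDx n f) ((k : ℝ) / n) ((j : ℝ) / n) = 0)
    (h0 : ∀ j : ℤ, -(n : ℤ) ^ 2 ≤ j → j < (n : ℤ) ^ 2 → f 0 ((j : ℝ) / n) = u j)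
    (hu : ∀ j, M ≤ j → u j = 0) (hM : M ≤ (n : ℤ) ^ 2 - 1) (k : ℕ) (hk : (k : ℤ) ≤ (n : ℤ) ^ 2 - 1) :
    ∀ j : ℤ, -(n : ℤ) ^ 2 ≤ j → j < (n : ℤ) ^ 2 →
      f ((k : ℝ) / n) ((j : ℝ) / n) = explicitScheme n u k j := by
  have hn' : (n : ℂ) ≠ 0 := Nat.cast_ne_zero.mpr hn
  induction k with
  | zero => intro j h1 h2; simpa [explicitScheme] using h0 j h1 h2
  | succ k ih =>
    intro j h1 h2
    push_cast at hk
    have ih' := ih (by omega)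
    have hz := explicitScheme_eq_zero_of_le (n := n) hu k
    have key := heat k (by omega) j h1 h2
    rw [discreteDt_grid hn f (by omega), discreteDx_grid hn _ _ j, discreteDx_grid hn _ _ j,
      discreteDx_grid hn _ _ (j + 1), ih' j h1 h2] at key
    rw [explicitScheme_succ]
    refine mul_left_cancel₀ hn' ?_
    rcases lt_trichotomy j ((n : ℤ) ^ 2 - 2) with hj | hj | hj
    · rw [if_pos (by omega), if_pos (by omega), if_pos (by omega), ih' (j + 1) (by omega) (by omega),
        ih' (j + 1 + 1) (by omega) (by omega), add_assoc j 1 1, one_add_one_eq_two] at key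
      linear_combination key
    -- Next-to-last cell: the inner difference quotient at `n ^ 2 - 1` is `0` by convention. The
    -- scheme agrees because its values vanish from `n ^ 2 - 1` on.
    · rw [if_pos (by omega), if_neg (by omega), if_pos (by omega),
        ih' (j + 1) (by omega) (by omega), hz (j + 1) (by omega)] at key
      rw [hz (j + 1) (by omega), hz (j + 2) (by omega)]
      linear_combination key
    · rw [if_neg (by omega)] at key
      rw [hz (j + 1) (by omega), hz (j + 2) (by omega), hz j (by omega)]
      rw [hz j (by omega)] at key
      linear_combination key

/-- A function measurable for the cell algebras is constant on cells. -/
lemma IsDiscreteMeasurable.eq_floor {n : ℕ} (hn : n ≠ 0) {f : ℝ → ℝ → ℂ}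
    (hf : IsDiscreteMeasurable n f) {t x : ℝ} (ht : t ∈ Set.Ico 0 (n : ℝ))
    (hx : x ∈ Set.Ico (-(n : ℝ)) n) : f t x = f ((⌊(n : ℝ) * t⌋ : ℝ) / n) x := by
  have hn' : (0 : ℝ) < n := by positivity
  have hfl : (⌊(n : ℝ) * t⌋ : ℝ) ≤ n * t := Int.floor_le _
  have hfl0 : (0 : ℝ) ≤ (⌊(n : ℝ) * t⌋ : ℝ) := by
    exact_mod_cast Int.floor_nonneg.mpr (mul_nonneg hn'.le ht.1)
  have hle : (⌊(n : ℝ) * t⌋ : ℝ) / n ≤ t := by rw [div_le_iff₀ hn']; linarith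
  have ht' : (⌊(n : ℝ) * t⌋ : ℝ) / n ∈ Set.Ico 0 (n : ℝ) :=
    ⟨div_nonneg hfl0 hn'.le, hle.trans_lt ht.2⟩
  have cell : ∀ r : ℝ, ∀ j : ℤ, ((j : ℝ) / n ≤ r ∧ r < ((j : ℝ) + 1) / n) ↔ ⌊(n : ℝ) * r⌋ = j := by
    intro r j
    rw [Int.floor_eq_iff, div_le_iff₀ hn', lt_div_iff₀ hn', mul_comm r]
  -- No set of the algebra separates `t` from the left end of its cell: this holds for the
  -- generators and survives complements and unions.
  have key : ∀ S : Set (Set.Ico 0 (n : ℝ)),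
      @MeasurableSet _ (cellAlgebra n (Set.Ico 0 (n : ℝ))) S → ((⟨t, ht⟩ : Set.Ico 0 (n : ℝ)) ∈ S ↔
        (⟨_, ht'⟩ : Set.Ico 0 (n : ℝ)) ∈ S) := by
    intro S hS
    induction S, hS using MeasurableSpace.generateFrom_induction with
    | hC S hS =>
      obtain ⟨j, rfl⟩ := hS
      simp only [Set.mem_ofPred_eq, cell, floor_mul_div hn]
    | empty => simp
    | compl S _ ih => simpa using not_congr ih
    | iUnion s _ ih => simp only [Set.mem_iUnion]; exact exists_congr ih
  let m1 : MeasurableSpace (Set.Ico 0 (n : ℝ)) := cellAlgebra n (Set.Ico 0 (n : ℝ))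
  let m2 : MeasurableSpace (Set.Ico (-(n : ℝ)) n) := cellAlgebra n (Set.Ico (-(n : ℝ)) n)
  have hm : @Measurable _ _ m1 _ (fun p : Set.Ico 0 (n : ℝ) => f p x) :=
    Measurable.comp (g := fun p : Set.Ico 0 (n : ℝ) × Set.Ico (-(n : ℝ)) n => f p.1 p.2) hf
      (@measurable_prodMk_right _ _ m1 m2 ⟨x, hx⟩)
  exact (Set.mem_singleton_iff.mp (Set.mem_preimage.mp
    ((key _ (hm (measurableSet_singleton (f t x)))).mp (Set.mem_preimage.mpr rfl)))).symm

/-! ### Fourier representation of the smoothed solution -/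

/-- The factor by which one time step multiplies the Fourier mode of frequency `ξ`. -/
noncomputable def multiplier (n : ℕ) (ξ : ℝ) : ℂ :=
  1 + n * (Complex.exp (Real.pi * Complex.I * ξ / n) - 1) ^ 2

/-- The kernel taking the initial data to the smoothed solution after `k` time steps. -/
noncomputable def discreteKernel (n w k : ℕ) (z : ℝ) : ℂ :=
  1 / (2 * n) * ∑ l ∈ Finset.Icc (-((w : ℤ) * n)) ((w : ℤ) * n),
    multiplier n ((l : ℝ) / n) ^ k * Complex.exp (Real.pi * Complex.I * ((l : ℝ) / n : ℝ) * z)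

/-- Reduction modulo `2 n` changes `m` by a multiple of `2 n ^ 2`, a period of `exp (π i l m / n ^
2)`; it can therefore be ignored. -/
lemma discreteInvFourier_cutoff {n w : ℕ} (hw : w < n) (t : ℝ) (m : ℤ) :
    discreteInvFourier n (discreteCutoff n w) t (wrap n ((m : ℝ) / n)) =
      1 / (2 * n) * ∑ l ∈ Finset.Icc (-((w : ℤ) * n)) ((w : ℤ) * n),
        Complex.exp (Real.pi * Complex.I * ((l : ℝ) / n : ℝ) * ((m : ℝ) / n : ℝ)) := by
  have hn : n ≠ 0 := by omega
  have hnR : (n : ℝ) ≠ 0 := Nat.cast_ne_zero.mpr hn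
  have hnC : (n : ℂ) ≠ 0 := Nat.cast_ne_zero.mpr hn
  have hwn : (w : ℤ) * n < (n : ℤ) ^ 2 := by
    rw [sq]; exact_mod_cast Nat.mul_lt_mul_of_pos_right hw (by omega)
  have hwrap : ∃ q : ℤ, wrap n ((m : ℝ) / n) = ((m - 2 * n ^ 2 * q : ℤ) : ℝ) / n := by
    refine ⟨⌊((m : ℝ) / n + n) / (2 * n)⌋, ?_⟩
    rw [wrap]
    push_cast
    field_simp
  obtain ⟨q, hq⟩ := hwrap
  unfold discreteInvFourier discreteIntegral discreteCutoff
  rw [hq, ← Finset.sum_subset (s₁ := Finset.Icc (-((w : ℤ) * n)) ((w : ℤ) * n)), Finset.mul_sum,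
    Finset.mul_sum]
  · refine Finset.sum_congr rfl fun l hl => ?_
    beta_reduce
    rw [floor_mul_div hn, floor_mul_div hn, if_pos (Finset.mem_Icc.mp hl)]
    have h1 : (Real.pi : ℂ) * Complex.I * ((l : ℝ) / n : ℝ) *
        (((m - 2 * n ^ 2 * q : ℤ) : ℝ) / n : ℝ) =
        Real.pi * Complex.I * ((l : ℝ) / n : ℝ) * ((m : ℝ) / n : ℝ) +
          (-(l * q) : ℤ) * (2 * Real.pi * Complex.I) := by
      push_cast
      field_simp
      ring
    rw [h1, Complex.exp_add, Complex.exp_int_mul_two_pi_mul_I]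
    field_simp
  · intro l hl
    rw [Finset.mem_Icc] at hl
    rw [Finset.mem_Ico]
    constructor <;> omega
  · intro l _ hl
    rw [Finset.mem_Icc] at hl
    beta_reduce
    rw [floor_mul_div hn, if_neg hl, zero_mul]

/-- After exchanging the sums, the inner one is the Fourier transform of the evolved data, that is,
a power of the multiplier times the transform of `u`. The bound on `M + 2 * k` keeps the support,
inside `[-M - 2 k, M)`, within the window of summation. -/
lemma discreteConv_eq_sum {n w k : ℕ} (hw : w < n) {f : ℝ → ℝ → ℂ} {u : ℤ → ℂ} {M : ℤ} {t : ℝ}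
    (hf : ∀ j : ℤ, -(n : ℤ) ^ 2 ≤ j → j < (n : ℤ) ^ 2 → f t ((j : ℝ) / n) = explicitScheme n u k j)
    (hu : ∀ j, M ≤ j → u j = 0) (hu' : ∀ j, j < -M → u j = 0) (hM : M + 2 * k ≤ (n : ℤ) ^ 2)
    (x : ℝ) :
    discreteConv n (discreteInvFourier n (discreteCutoff n w)) f t x =
      1 / n * ∑ j ∈ Finset.Ico (-M) M, u j * discreteKernel n w k (((⌊(n : ℝ) * x⌋ - j : ℤ) : ℝ) / n) := by
  have hn : n ≠ 0 := by omega
  have hnC : (n : ℂ) ≠ 0 := Nat.cast_ne_zero.mpr hn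
  set i := ⌊(n : ℝ) * x⌋ with hi
  have hfourier : ∀ c : ℂ, ∑ j ∈ Finset.Ico (-((n : ℤ) ^ 2)) ((n : ℤ) ^ 2),
      explicitScheme n u k j * Complex.exp (c * j) =
      (1 + n * (Complex.exp (-c) - 1) ^ 2) ^ k * ∑ j ∈ Finset.Ico (-M) M, u j * Complex.exp (c * j) := by
    intro c
    have h0 : HasSum (fun j : ℤ => u j * Complex.exp (c * j))
        (∑ j ∈ Finset.Ico (-M) M, u j * Complex.exp (c * j)) := by
      refine hasSum_sum_of_ne_finset_zero fun j hj => ?_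
      rw [Finset.mem_Ico, not_and_or, not_le, not_lt] at hj
      rcases hj with hj | hj
      · rw [hu' j hj, zero_mul]
      · rw [hu j hj, zero_mul]
    refine (hasSum_sum_of_ne_finset_zero fun j hj => ?_).unique (hasSum_explicitScheme h0 k)
    rw [Finset.mem_Ico, not_and_or, not_le, not_lt] at hj
    rcases hj with hj | hj
    · rw [explicitScheme_eq_zero_of_lt hu' k j (by omega), zero_mul]
    · rw [explicitScheme_eq_zero_of_le hu k j (by omega), zero_mul]
  have hsplit : ∀ l j : ℤ, Complex.exp (Real.pi * Complex.I * ((l : ℝ) / n : ℝ) *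
      (((i - j : ℤ) : ℝ) / n : ℝ)) = Complex.exp (Real.pi * Complex.I * ((l : ℝ) / n : ℝ) * ((i : ℝ) / n : ℝ)) *
        Complex.exp (-(Real.pi * Complex.I * ((l : ℝ) / n : ℝ) / n) * j) := by
    intro l j
    rw [← Complex.exp_add]
    congr 1
    push_cast
    field_simp
    ring
  unfold discreteConv discreteIntegral
  congr 1
  calc _ = ∑ j ∈ Finset.Ico (-((n : ℤ) ^ 2)) ((n : ℤ) ^ 2), 1 / (2 * n) *
        ∑ l ∈ Finset.Icc (-((w : ℤ) * n)) ((w : ℤ) * n),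
          Complex.exp (Real.pi * Complex.I * ((l : ℝ) / n : ℝ) * ((i : ℝ) / n : ℝ)) *
          (explicitScheme n u k j * Complex.exp (-(Real.pi * Complex.I * ((l : ℝ) / n : ℝ) / n) * j)) := by
        refine Finset.sum_congr rfl fun j hj => ?_
        rw [Finset.mem_Ico] at hj
        beta_reduce
        rw [hf j hj.1 hj.2, ← sub_div, ← Int.cast_sub, discreteInvFourier_cutoff hw, mul_assoc,
          Finset.sum_mul]
        congr 1
        refine Finset.sum_congr rfl fun l _ => ?_
        rw [hsplit]
        ring
    _ = 1 / (2 * n) * ∑ l ∈ Finset.Icc (-((w : ℤ) * n)) ((w : ℤ) * n),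
          Complex.exp (Real.pi * Complex.I * ((l : ℝ) / n : ℝ) * ((i : ℝ) / n : ℝ)) *
          (multiplier n ((l : ℝ) / n) ^ k * ∑ j ∈ Finset.Ico (-M) M,
            u j * Complex.exp (-(Real.pi * Complex.I * ((l : ℝ) / n : ℝ) / n) * j)) := by
        rw [← Finset.mul_sum, Finset.sum_comm]
        congr 1
        refine Finset.sum_congr rfl fun l _ => ?_
        rw [← Finset.mul_sum, hfourier, neg_neg, multiplier]
    _ = _ := by
        simp only [discreteKernel, Finset.mul_sum]
        rw [Finset.sum_comm]
        refine Finset.sum_congr rfl fun j _ => Finset.sum_congr rfl fun l _ => ?_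
        rw [hsplit]
        ring

/-! ### Growth of the data and size of the multiplier at low frequencies -/

open MeasureTheory

/-- Since `ρ < 2`, `B |x| ^ ρ` is eventually below `ε x ^ 2`; compactness handles the remaining
interval. -/
lemma exists_norm_le_exp_sq {g : ℝ → ℂ} (hg : Continuous g)
    (hgrowth : ∃ A B ρ : ℝ, ρ < 2 ∧ ∀ x : ℝ, ‖g x‖ ≤ A * Real.exp (B * |x| ^ ρ))
    {ε : ℝ} (hε : 0 < ε) : ∃ C : ℝ, 0 ≤ C ∧ ∀ x, ‖g x‖ ≤ C * Real.exp (ε * x ^ 2) := by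
  obtain ⟨A, B, ρ, hρ, hAB⟩ := hgrowth
  have h1 : Tendsto (fun x : ℝ => B * x ^ (-(2 - ρ))) atTop (𝓝 0) := by
    simpa using (tendsto_rpow_neg_atTop (sub_pos.mpr hρ)).const_mul B
  obtain ⟨M, hM⟩ := eventually_atTop.mp ((h1.eventually (ge_mem_nhds hε)).and (eventually_gt_atTop 0))
  obtain ⟨C, hC⟩ := (isCompact_Icc (a := -|M|) (b := |M|)).exists_bound_of_continuousOn hg.continuousOn
  refine ⟨max |A| |C|, (abs_nonneg A).trans (le_max_left _ _), fun x => ?_⟩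
  by_cases hx : |x| ≤ |M|
  · have h2 : ‖g x‖ ≤ |C| := (hC x (abs_le.mp hx)).trans (le_abs_self C)
    have h3 : 1 ≤ Real.exp (ε * x ^ 2) := Real.one_le_exp (by positivity)
    calc ‖g x‖ ≤ |C| * 1 := by linarith
      _ ≤ _ := by gcongr; exact le_max_right _ _
  · obtain ⟨h2, h3⟩ := hM |x| ((le_abs_self M).trans (not_le.mp hx).le)
    have h4 : B * |x| ^ ρ ≤ ε * x ^ 2 := by
      have : |x| ^ ρ = |x| ^ (-(2 - ρ)) * x ^ 2 := by
        rw [← sq_abs x, ← Real.rpow_natCast, ← Real.rpow_add h3]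
        congr 1; push_cast; ring
      rw [this, ← mul_assoc]
      gcongr
    calc ‖g x‖ ≤ A * Real.exp (B * |x| ^ ρ) := hAB x
      _ ≤ max |A| |C| * Real.exp (ε * x ^ 2) := by
        gcongr
        exact (le_abs_self A).trans (le_max_left _ _)

/-- Errors made in successive steps add up, since `b` is a contraction and `a` expands by at most `1
+ δ`. -/
lemma norm_pow_sub_pow_le {a b : ℂ} {δ : ℝ} (hb : ‖b‖ ≤ 1) (hab : ‖a - b‖ ≤ δ) (k : ℕ) :
    ‖a ^ k - b ^ k‖ ≤ k * δ * (1 + δ) ^ k := by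
  have hδ : 0 ≤ δ := (norm_nonneg _).trans hab
  have ha : ‖a‖ ≤ 1 + δ := by
    calc ‖a‖ = ‖b + (a - b)‖ := by ring_nf
      _ ≤ _ := (norm_add_le _ _).trans (add_le_add hb hab)
  induction k with
  | zero => simp
  | succ k ih =>
    have h1 : (1 : ℝ) ≤ (1 + δ) ^ (k + 1) := one_le_pow₀ (by linarith)
    calc ‖a ^ (k + 1) - b ^ (k + 1)‖ = ‖a * (a ^ k - b ^ k) + (a - b) * b ^ k‖ := by ring_nf
      _ ≤ ‖a‖ * ‖a ^ k - b ^ k‖ + ‖a - b‖ * ‖b‖ ^ k := by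
        refine (norm_add_le _ _).trans ?_
        rw [norm_mul, norm_mul, norm_pow]
      _ ≤ (1 + δ) * (k * δ * (1 + δ) ^ k) + δ * 1 := by
        gcongr
        exact pow_le_one₀ (norm_nonneg _) hb
      _ ≤ (1 + δ) * (k * δ * (1 + δ) ^ k) + δ * (1 + δ) ^ (k + 1) := by gcongr
      _ = _ := by push_cast; ring

/-- With `u = π i ξ / n` and `v = n u ^ 2 = -π ^ 2 ξ ^ 2 / n`, both sides agree with `1 + v`: the
multiplier up to `n O(u ^ 3)`, the exponential up to `O(v ^ 2)`. The condition `10 * w ^ 2 ≤ n`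
ensures `‖v‖ ≤ 1`, because `π ^ 2 ≤ 10`. -/
lemma norm_multiplier_sub_exp_le {n w : ℕ} (hw : 1 ≤ w) (hwn : 10 * w ^ 2 ≤ n) {ξ : ℝ}
    (hξ : |ξ| ≤ w) :
    ‖multiplier n ξ - (Real.exp (-(Real.pi ^ 2 * ξ ^ 2 / n)) : ℝ)‖ ≤ 200 * (w : ℝ) ^ 4 / n ^ 2 := by
  have hwR : (1 : ℝ) ≤ w := by exact_mod_cast hw
  have hwnR : 10 * (w : ℝ) ^ 2 ≤ n := by exact_mod_cast hwn
  have hn : (0 : ℝ) < n := by nlinarith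
  have hnC : (n : ℂ) ≠ 0 := by exact_mod_cast hn.ne'
  have hπ : Real.pi ≤ 3.142 := Real.pi_lt_d4.le.trans (by norm_num)
  have hπ0 := Real.pi_pos
  set u : ℂ := Real.pi * Complex.I * ξ / n with hu
  have hu1 : ‖u‖ ≤ Real.pi * w / n := by
    rw [hu, norm_div, norm_mul, norm_mul, Complex.norm_I, Complex.norm_real, Complex.norm_real,
      Complex.norm_natCast, Real.norm_eq_abs, Real.norm_eq_abs, abs_of_pos hπ0, mul_one]
    gcongr
  have hu2 : Real.pi * w / n ≤ 1 := by
    rw [div_le_one hn]; nlinarith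
  set v : ℂ := n * u ^ 2 with hv
  have hv1 : ‖v‖ ≤ Real.pi ^ 2 * w ^ 2 / n := by
    rw [hv, norm_mul, norm_pow, Complex.norm_natCast]
    calc (n : ℝ) * ‖u‖ ^ 2 ≤ n * (Real.pi * w / n) ^ 2 := by gcongr
      _ = _ := by field_simp
  have hv2 : Real.pi ^ 2 * w ^ 2 / n ≤ 1 := by
    rw [div_le_one hn]
    have : Real.pi ^ 2 ≤ 10 := by nlinarith
    nlinarith [sq_nonneg (w : ℝ)]
  have hexp : ((Real.exp (-(Real.pi ^ 2 * ξ ^ 2 / n)) : ℝ) : ℂ) = Complex.exp v := by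
    rw [Complex.ofReal_exp]
    congr 1
    rw [hv, hu, div_pow, mul_pow, mul_pow, Complex.I_sq]
    push_cast
    field_simp
  have h1 := Complex.norm_exp_sub_one_sub_id_le (hu1.trans hu2)
  have h2 := Complex.norm_exp_sub_one_sub_id_le (hv1.trans hv2)
  rw [hexp, multiplier, ← hu]
  set r := Complex.exp u - 1 - u with hr
  have h3 : 1 + (n : ℂ) * (Complex.exp u - 1) ^ 2 - Complex.exp v =
      n * (r * (2 * u + r)) - (Complex.exp v - 1 - v) := by
    rw [hv, hr]; ring
  have hr1 : ‖2 * u + r‖ ≤ 3 * ‖u‖ := by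
    have : ‖u‖ ^ 2 ≤ ‖u‖ := by nlinarith [norm_nonneg u, hu1.trans hu2]
    calc ‖2 * u + r‖ ≤ 2 * ‖u‖ + ‖r‖ := by
          refine (norm_add_le _ _).trans ?_
          rw [norm_mul, Complex.norm_two]
      _ ≤ _ := by linarith
  rw [h3]
  calc _ ≤ n * (‖r‖ * ‖2 * u + r‖) + ‖Complex.exp v - 1 - v‖ := by
        refine (norm_sub_le _ _).trans ?_
        rw [norm_mul, norm_mul, Complex.norm_natCast]
    _ ≤ n * ((Real.pi * w / n) ^ 2 * (3 * (Real.pi * w / n))) + (Real.pi ^ 2 * w ^ 2 / n) ^ 2 := by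
        gcongr
        · exact h1.trans (by gcongr)
        · exact hr1.trans (by gcongr)
        · exact h2.trans (by gcongr)
    _ = (3 * Real.pi ^ 3 * w ^ 3 + Real.pi ^ 4 * w ^ 4) / n ^ 2 := by field_simp
    _ ≤ 200 * (w : ℝ) ^ 4 / n ^ 2 := by
        gcongr
        have h5 : Real.pi ^ 3 ≤ 3.142 ^ 3 := by gcongr
        have h6 : Real.pi ^ 4 ≤ 3.142 ^ 4 := by gcongr
        have h7 : (w : ℝ) ^ 3 ≤ w ^ 4 := pow_le_pow_right₀ hwR (by norm_num)
        calc 3 * Real.pi ^ 3 * (w : ℝ) ^ 3 + Real.pi ^ 4 * w ^ 4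
            ≤ 3 * 3.142 ^ 3 * (w : ℝ) ^ 4 + 3.142 ^ 4 * w ^ 4 := by gcongr
          _ ≤ _ := by
            rw [← add_mul]
            gcongr
            norm_num

/-! ### Riemann sums -/

/-- Sums over the grid are integrals of step functions. -/
lemma stepFunction_integral {n : ℕ} (hn : n ≠ 0) (h : ℝ → ℂ) {a b : ℤ} (hab : a ≤ b) :
    IntervalIntegrable (fun y => h ((⌊(n : ℝ) * y⌋ : ℝ) / n)) volume ((a : ℝ) / n) ((b : ℝ) / n) ∧
    ∫ y in ((a : ℝ) / n)..((b : ℝ) / n), h ((⌊(n : ℝ) * y⌋ : ℝ) / n) =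
      1 / n * ∑ j ∈ Finset.Ico a b, h ((j : ℝ) / n) := by
  have hn' : (0 : ℝ) < n := by positivity
  have cell : ∀ j : ℤ, Set.EqOn (fun _ => h ((j : ℝ) / n)) (fun y => h ((⌊(n : ℝ) * y⌋ : ℝ) / n))
      (Set.uIoo ((j : ℝ) / n) (((j + 1 : ℤ) : ℝ) / n)) := by
    intro j y hy
    rw [Set.uIoo_of_le (by gcongr; norm_num), Set.mem_Ioo, div_lt_iff₀ hn', lt_div_iff₀ hn'] at hy
    have : ⌊(n : ℝ) * y⌋ = j := by
      rw [Int.floor_eq_iff]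
      push_cast at hy
      constructor <;> linarith
    simp only [this]
  induction b, hab using Int.leInduction with
  | base => simp
  | succ b hab ih =>
    have hint : IntervalIntegrable (fun y => h ((⌊(n : ℝ) * y⌋ : ℝ) / n)) volume
        ((b : ℝ) / n) (((b + 1 : ℤ) : ℝ) / n) :=
      (intervalIntegrable_const (c := h ((b : ℝ) / n))).congr_uIoo (cell b)
    refine ⟨ih.1.trans hint, ?_⟩
    rw [← intervalIntegral.integral_add_adjacent_intervals ih.1 hint, ih.2,
      ← intervalIntegral.integral_congr_uIoo (cell b), intervalIntegral.integral_const,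
      ← Finset.insert_Ico_right_eq_Ico_add_one hab, Finset.sum_insert (by simp), Complex.real_smul]
    push_cast
    field_simp
    ring

lemma abs_floor_mul_div_sub_le {n : ℕ} (hn : n ≠ 0) (y : ℝ) :
    |(⌊(n : ℝ) * y⌋ : ℝ) / n - y| ≤ 1 / n := by
  have hn' : (0 : ℝ) < n := by positivity
  have h1 := Int.floor_le ((n : ℝ) * y)
  have h2 := Int.lt_floor_add_one ((n : ℝ) * y)
  have h3 : (⌊(n : ℝ) * y⌋ : ℝ) / n - y = ((⌊(n : ℝ) * y⌋ : ℝ) - n * y) / n := by field_simp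
  rw [h3, abs_div, abs_of_pos hn']
  gcongr
  rw [abs_le]
  constructor <;> linarith

lemma norm_riemannSum_sub_integral_le {n : ℕ} (hn : n ≠ 0) {φ : ℝ → ℂ} (hφ : Continuous φ) {L : ℝ}
    (hL : ∀ x y, ‖φ x - φ y‖ ≤ L * |x - y|) {a b : ℤ} (hab : a ≤ b) :
    ‖1 / n * ∑ j ∈ Finset.Ico a b, φ ((j : ℝ) / n) - ∫ y in ((a : ℝ) / n)..((b : ℝ) / n), φ y‖ ≤
      L / n * (((b : ℝ) - a) / n) := by
  have hn' : (0 : ℝ) < n := by positivity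
  have hL0 : 0 ≤ L := by simpa using (norm_nonneg _).trans (hL 1 0)
  obtain ⟨h1, h2⟩ := stepFunction_integral hn φ hab
  rw [← h2, ← intervalIntegral.integral_sub h1 (hφ.intervalIntegrable _ _)]
  have hab' : (a : ℝ) ≤ b := by exact_mod_cast hab
  have h3 : |(b : ℝ) / n - a / n| = ((b : ℝ) - a) / n := by
    rw [← sub_div, abs_of_nonneg (div_nonneg (by linarith) hn'.le)]
  rw [← h3]
  refine intervalIntegral.norm_integral_le_of_norm_le_const fun y _ => (hL _ _).trans ?_
  rw [div_eq_mul_one_div L]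
  gcongr
  exact abs_floor_mul_div_sub_le hn y

/-! ### The heat kernel as a Fourier integral -/

/-- The heat kernel. -/
noncomputable def heatKernel (s z : ℝ) : ℝ :=
  1 / Real.sqrt (4 * Real.pi * s) * Real.exp (-z ^ 2 / (4 * s))

/-- The Fourier mode of frequency `ξ` at the point `z`, damped by the heat flow up to time `s`. -/
noncomputable def dampedMode (s z ξ : ℝ) : ℂ :=
  (Real.exp (-(Real.pi ^ 2 * s) * ξ ^ 2) : ℝ) * Complex.exp (Real.pi * Complex.I * ξ * z)

lemma norm_exp_pi_mul_I (ξ z : ℝ) : ‖Complex.exp (Real.pi * Complex.I * ξ * z)‖ = 1 := by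
  rw [show (Real.pi * Complex.I * ξ * z : ℂ) = ((Real.pi * ξ * z : ℝ) : ℂ) * Complex.I by
    push_cast; ring, Complex.norm_exp_ofReal_mul_I]

lemma norm_dampedMode (s z ξ : ℝ) :
    ‖dampedMode s z ξ‖ = Real.exp (-(Real.pi ^ 2 * s) * ξ ^ 2) := by
  rw [dampedMode, norm_mul, norm_exp_pi_mul_I, mul_one, Complex.norm_real, Real.norm_eq_abs,
    abs_of_pos (Real.exp_pos _)]

lemma continuous_dampedMode (s z : ℝ) : Continuous (dampedMode s z) := by
  unfold dampedMode
  fun_prop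

lemma integrable_dampedMode {s : ℝ} (hs : 0 < s) (z : ℝ) : Integrable (dampedMode s z) := by
  refine (integrable_exp_neg_mul_sq (b := Real.pi ^ 2 * s) (by positivity)).mono'
    (continuous_dampedMode s z).aestronglyMeasurable (Eventually.of_forall fun ξ => ?_)
  rw [norm_dampedMode]

lemma half_integral_dampedMode {s : ℝ} (hs : 0 < s) (z : ℝ) :
    1 / 2 * ∫ ξ, dampedMode s z ξ = heatKernel s z := by
  have hπ := Real.pi_pos
  have h1 := fourierIntegral_gaussian (b := ((Real.pi ^ 2 * s : ℝ) : ℂ))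
    (by rw [Complex.ofReal_re]; positivity) ((Real.pi * z : ℝ) : ℂ)
  have h2 : ∀ ξ : ℝ, dampedMode s z ξ = Complex.exp (Complex.I * ((Real.pi * z : ℝ) : ℂ) * ξ) *
      Complex.exp (-((Real.pi ^ 2 * s : ℝ) : ℂ) * ξ ^ 2) := by
    intro ξ
    rw [dampedMode, mul_comm]
    push_cast
    congr 2
    ring
  have h3 : ((Real.pi : ℂ) / ((Real.pi ^ 2 * s : ℝ) : ℂ)) ^ (1 / 2 : ℂ) =
      ((Real.sqrt (1 / (Real.pi * s)) : ℝ) : ℂ) := by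
    rw [Real.sqrt_eq_rpow, Complex.ofReal_cpow (by positivity)]
    push_cast
    congr 1
    field_simp
  have h4 : 1 / 2 * Real.sqrt (1 / (Real.pi * s)) = 1 / Real.sqrt (4 * Real.pi * s) := by
    rw [mul_assoc, Real.sqrt_mul (by norm_num), show (4 : ℝ) = 2 ^ 2 by norm_num,
      Real.sqrt_sq (by norm_num), Real.sqrt_div zero_le_one, Real.sqrt_one]
    field_simp
  simp_rw [h2]
  rw [h1, h3, heatKernel, ← h4]
  push_cast
  rw [mul_assoc]
  congr 3
  field_simp

lemma norm_dampedMode_sub_le {s : ℝ} (hs : 0 ≤ s) (z x y : ℝ) :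
    ‖dampedMode s z x - dampedMode s z y‖ ≤ (Real.pi ^ 2 * s + 1 + Real.pi * |z|) * |x - y| := by
  have hπ := Real.pi_pos
  have hd : ∀ ξ : ℝ, HasDerivAt (dampedMode s z)
      (dampedMode s z ξ * ((-(2 * (Real.pi ^ 2 * s) * ξ) : ℝ) + Real.pi * Complex.I * z)) ξ := by
    intro ξ
    have h1 : HasDerivAt (fun ξ : ℝ => Complex.exp
        ((-(Real.pi ^ 2 * s) : ℝ) * (ξ : ℂ) ^ 2 + Real.pi * Complex.I * z * ξ))
        (Complex.exp ((-(Real.pi ^ 2 * s) : ℝ) * (ξ : ℂ) ^ 2 + Real.pi * Complex.I * z * ξ) *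
          ((-(Real.pi ^ 2 * s) : ℝ) * (2 * ξ) + Real.pi * Complex.I * z)) ξ := by
      have h2 : HasDerivAt (fun ξ : ℂ => Complex.exp
          ((-(Real.pi ^ 2 * s) : ℝ) * ξ ^ 2 + Real.pi * Complex.I * z * ξ))
          (Complex.exp ((-(Real.pi ^ 2 * s) : ℝ) * (ξ : ℂ) ^ 2 + Real.pi * Complex.I * z * ξ) *
          ((-(Real.pi ^ 2 * s) : ℝ) * (2 * ξ) + Real.pi * Complex.I * z)) (ξ : ℂ) := by
        refine HasDerivAt.cexp ?_
        refine HasDerivAt.add ?_ ?_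
        · refine ((hasDerivAt_pow 2 (ξ : ℂ)).const_mul _).congr_deriv ?_
          norm_num
        · simpa using (hasDerivAt_id (ξ : ℂ)).const_mul (Real.pi * Complex.I * z)
      exact h2.comp_ofReal
    have h3 : ∀ ξ : ℝ, dampedMode s z ξ = Complex.exp
        ((-(Real.pi ^ 2 * s) : ℝ) * (ξ : ℂ) ^ 2 + Real.pi * Complex.I * z * ξ) := by
      intro ξ
      rw [dampedMode, Complex.ofReal_exp, ← Complex.exp_add]
      push_cast
      congr 1
      ring
    rw [show dampedMode s z = _ from funext h3]
    convert h1 using 1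
    push_cast
    ring
  have hb : ∀ ξ : ℝ, ‖dampedMode s z ξ *
      ((-(2 * (Real.pi ^ 2 * s) * ξ) : ℝ) + Real.pi * Complex.I * z)‖ ≤
      Real.pi ^ 2 * s + 1 + Real.pi * |z| := by
    intro ξ
    set a := Real.pi ^ 2 * s with ha
    have ha0 : 0 ≤ a := by positivity
    have h1 : Real.exp (-a * ξ ^ 2) ≤ 1 := Real.exp_le_one_iff.mpr (by nlinarith [sq_nonneg ξ])
    have h2 : a * ξ ^ 2 * Real.exp (-a * ξ ^ 2) ≤ 1 := by
      calc a * ξ ^ 2 * Real.exp (-a * ξ ^ 2)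
          ≤ Real.exp (a * ξ ^ 2) * Real.exp (-a * ξ ^ 2) := by
            gcongr
            linarith [Real.add_one_le_exp (a * ξ ^ 2)]
        _ = 1 := by rw [← Real.exp_add]; simp
    -- This replaces the linear factor by a quadratic one, which `a ξ ^ 2 exp (-a ξ ^ 2) ≤ 1`
    -- absorbs; the Lipschitz constant is then uniform in `ξ`.
    have h3 : 2 * a * |ξ| ≤ a + a * ξ ^ 2 := by
      rw [← sq_abs ξ]; nlinarith [sq_nonneg (|ξ| - 1)]
    rw [norm_mul, norm_dampedMode, ← ha]
    have h4 : ‖(((-(2 * a * ξ) : ℝ) : ℂ) + Real.pi * Complex.I * z)‖ ≤ 2 * a * |ξ| + Real.pi * |z| := by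
      refine (norm_add_le _ _).trans (le_of_eq ?_)
      rw [Complex.norm_real, norm_mul, norm_mul, Complex.norm_I, Complex.norm_real, Complex.norm_real,
        Real.norm_eq_abs, Real.norm_eq_abs, Real.norm_eq_abs, abs_neg, abs_mul,
        abs_of_nonneg (by positivity : 0 ≤ 2 * a), abs_of_pos hπ, mul_one]
    calc Real.exp (-a * ξ ^ 2) * _ ≤ Real.exp (-a * ξ ^ 2) * (a + a * ξ ^ 2 + Real.pi * |z|) := by
          gcongr; linarith
      _ = a * Real.exp (-a * ξ ^ 2) + a * ξ ^ 2 * Real.exp (-a * ξ ^ 2) +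
          Real.pi * |z| * Real.exp (-a * ξ ^ 2) := by ring
      _ ≤ a * 1 + 1 + Real.pi * |z| * 1 := by gcongr
      _ = _ := by ring
  have := Convex.norm_image_sub_le_of_norm_hasDerivWithin_le (f := dampedMode s z) (s := Set.univ)
    (fun ξ _ => (hd ξ).hasDerivWithinAt) (fun ξ _ => hb ξ) convex_univ (Set.mem_univ y)
    (Set.mem_univ x)
  simpa [Real.norm_eq_abs] using this

/-- The exponent is split in two halves: outside `[-w, w]` one half yields the small factor, and the
other is integrated over the whole line. -/
lemma norm_integral_sub_integral_dampedMode_le {s : ℝ} (hs : 0 < s) (z : ℝ) {w : ℝ} (hw : 0 ≤ w) :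
    ‖(∫ ξ in (-w)..w, dampedMode s z ξ) - ∫ ξ, dampedMode s z ξ‖ ≤
      Real.exp (-(Real.pi ^ 2 * s / 2) * w ^ 2) * Real.sqrt (Real.pi / (Real.pi ^ 2 * s / 2)) := by
  set a := Real.pi ^ 2 * s / 2 with ha
  have ha0 : 0 < a := by have := Real.pi_pos; positivity
  have hi := integrable_dampedMode hs z
  rw [intervalIntegral.integral_of_le (by linarith), norm_sub_rev,
    ← setIntegral_compl measurableSet_Ioc hi, ← integral_gaussian, ← integral_const_mul]
  have hg : Integrable fun ξ : ℝ => Real.exp (-a * w ^ 2) * Real.exp (-a * ξ ^ 2) :=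
    (integrable_exp_neg_mul_sq ha0).const_mul _
  calc _ ≤ ∫ ξ in (Set.Ioc (-w) w)ᶜ, ‖dampedMode s z ξ‖ := norm_integral_le_integral_norm _
    _ ≤ ∫ ξ in (Set.Ioc (-w) w)ᶜ, Real.exp (-a * w ^ 2) * Real.exp (-a * ξ ^ 2) := by
      refine setIntegral_mono_on hi.norm.integrableOn hg.integrableOn measurableSet_Ioc.compl
        fun ξ hξ => ?_
      have h1 : w ^ 2 ≤ ξ ^ 2 := by
        rw [Set.mem_compl_iff, Set.mem_Ioc, not_and_or, not_lt, not_le] at hξ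
        rcases hξ with h | h <;> nlinarith
      rw [norm_dampedMode, ← Real.exp_add]
      apply Real.exp_le_exp.mpr
      rw [show Real.pi ^ 2 * s = 2 * a by rw [ha]; ring]
      nlinarith
    _ ≤ _ := setIntegral_le_integral hg (Eventually.of_forall fun ξ => by positivity)

/-- Three errors are added: powers of the multiplier against the Gaussian (`hE1`), Riemann sum
against integral (`hE2`), and truncation of the frequencies (`hE3`). The Lipschitz constant in `hE2`
grows with `|z|`, hence the restriction to `|z| ≤ R + w`. -/
lemma exists_norm_discreteKernel_sub_le {c T R : ℝ} (hc : 0 < c) (hT : 0 ≤ T) (hR : 0 ≤ R) :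
    ∃ P D a : ℝ, 0 ≤ P ∧ 0 ≤ D ∧ 0 < a ∧ ∀ (n w k : ℕ) (z : ℝ), 1 ≤ w → 10 * w ^ 2 ≤ n →
      200 * T * (w : ℝ) ^ 4 ≤ n → c ≤ (k : ℝ) / n → (k : ℝ) / n ≤ T → |z| ≤ R + w →
      ‖discreteKernel n w k z - heatKernel ((k : ℝ) / n) z‖ ≤
        P * (w : ℝ) ^ 5 / n + D * Real.exp (-a * (w : ℝ) ^ 2) := by
  have hπ := Real.pi_pos
  refine ⟨900 * T + (10 * T + 6 + 4 * R), Real.sqrt (Real.pi / (Real.pi ^ 2 * c / 2)),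
    Real.pi ^ 2 * c / 2, by positivity, by positivity, by positivity, ?_⟩
  intro n w k z hw hwn hTn hck hkT hz
  set s := (k : ℝ) / n with hs
  have hs0 : 0 < s := hc.trans_le hck
  have hwR : (1 : ℝ) ≤ w := by exact_mod_cast hw
  have hn : n ≠ 0 := by rintro rfl; simp [hs] at hs0
  have hnR : (0 : ℝ) < n := by positivity
  have hn1 : (1 : ℝ) ≤ n := by exact_mod_cast Nat.one_le_iff_ne_zero.mpr hn
  have hnC : (n : ℂ) ≠ 0 := Nat.cast_ne_zero.mpr hn
  set S := Finset.Icc (-((w : ℤ) * n)) ((w : ℤ) * n) with hS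
  have hcoef : ‖(1 / (2 * n) : ℂ)‖ = 1 / (2 * n) := by
    simp
  have hterm : ∀ l ∈ S, ‖multiplier n ((l : ℝ) / n) ^ k *
        Complex.exp (Real.pi * Complex.I * ((l : ℝ) / n : ℝ) * z) - dampedMode s z ((l : ℝ) / n)‖ ≤
        600 * T * w ^ 4 / n := by
    intro l hl
    have hξ : |(l : ℝ) / n| ≤ w := by
      rw [abs_div, abs_of_pos hnR, div_le_iff₀ hnR]
      rw [hS, Finset.mem_Icc, ← abs_le] at hl
      exact_mod_cast hl
    have h1 := norm_multiplier_sub_exp_le hw hwn hξ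
    have hpow : (Real.exp (-(Real.pi ^ 2 * s) * ((l : ℝ) / n) ^ 2) : ℝ) =
        (Real.exp (-(Real.pi ^ 2 * ((l : ℝ) / n) ^ 2 / n))) ^ k := by
      rw [← Real.exp_nat_mul]
      congr 1
      rw [hs]
      field_simp
    rw [dampedMode, hpow, Complex.ofReal_pow, ← sub_mul, norm_mul, norm_exp_pi_mul_I, mul_one]
    have hb1 : ‖((Real.exp (-(Real.pi ^ 2 * ((l : ℝ) / n) ^ 2 / n)) : ℝ) : ℂ)‖ ≤ 1 := by
      rw [Complex.norm_real, Real.norm_eq_abs, Real.abs_exp, Real.exp_le_one_iff, neg_nonpos]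
      positivity
    -- The hypothesis `hTn` gives `k δ ≤ 1`, so `(1 + δ) ^ k ≤ exp 1 ≤ 3`: the error accumulated
    -- over `k` steps stays of order `k δ`.
    refine (norm_pow_sub_pow_le hb1 h1 k).trans ?_
    set δ := 200 * (w : ℝ) ^ 4 / n ^ 2 with hδ
    have hkδ : k * δ ≤ 200 * T * w ^ 4 / n := by
      calc k * δ = 200 * s * w ^ 4 / n := by rw [hδ, hs]; field_simp
        _ ≤ _ := by gcongr
    have hkδ1 : k * δ ≤ 1 := hkδ.trans ((div_le_one hnR).mpr hTn)
    have hδ0 : 0 ≤ δ := by positivity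
    have hp : (1 + δ) ^ k ≤ 3 := by
      calc (1 + δ) ^ k ≤ Real.exp δ ^ k := by
            gcongr; linarith [Real.add_one_le_exp δ]
        _ = Real.exp (k * δ) := (Real.exp_nat_mul _ _).symm
        _ ≤ Real.exp 1 := Real.exp_le_exp.mpr hkδ1
        _ ≤ 3 := Real.exp_one_lt_d9.le.trans (by norm_num)
    calc k * δ * (1 + δ) ^ k ≤ 200 * T * w ^ 4 / n * 3 := by gcongr
      _ = _ := by ring
  have hE1 : ‖discreteKernel n w k z - 1 / (2 * n) * ∑ l ∈ S, dampedMode s z ((l : ℝ) / n)‖ ≤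
      900 * T * w ^ 5 / n := by
    rw [discreteKernel, ← mul_sub, ← Finset.sum_sub_distrib, norm_mul, hcoef]
    have hcard : (S.card : ℝ) ≤ 3 * w * n := by
      have h1 : (S.card : ℝ) = 2 * w * n + 1 := by
        rw [hS, Int.card_Icc]
        have : ((w : ℤ) * n + 1 - -((w : ℤ) * n)).toNat = 2 * w * n + 1 := by
          zify
          have : 0 ≤ (w : ℤ) * n := by positivity
          rw [Int.toNat_of_nonneg (by omega)]
          ring
        rw [this]; push_cast; ring
      rw [h1]; nlinarith
    calc 1 / (2 * n) * ‖_‖ ≤ 1 / (2 * n) * (S.card * (600 * T * w ^ 4 / n)) := by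
          gcongr
          refine (norm_sum_le_of_le _ hterm).trans ?_
          rw [Finset.sum_const, nsmul_eq_mul]
      _ ≤ 1 / (2 * n) * (3 * w * n * (600 * T * w ^ 4 / n)) := by gcongr
      _ = _ := by field_simp; ring
  have hE2 : ‖1 / (2 * n) * ∑ l ∈ S, dampedMode s z ((l : ℝ) / n) -
      1 / 2 * ∫ ξ in (-(w : ℝ))..w, dampedMode s z ξ‖ ≤ (10 * T + 6 + 4 * R) * w ^ 5 / n := by
    have hle : -((w : ℤ) * n) ≤ (w : ℤ) * n := by
      have : 0 ≤ (w : ℤ) * n := by positivity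
      omega
    have h1 := norm_riemannSum_sub_integral_le hn (continuous_dampedMode s z)
      (norm_dampedMode_sub_le hs0.le z) hle
    push_cast at h1
    rw [neg_div, mul_div_cancel_right₀ _ hnR.ne'] at h1
    -- The cut-off includes both end frequencies, so the sum has one term more than the Riemann sum;
    -- it costs at most `1 / (2 n)`.
    have h2 : ∑ l ∈ S, dampedMode s z ((l : ℝ) / n) = dampedMode s z w +
        ∑ l ∈ Finset.Ico (-((w : ℤ) * n)) ((w : ℤ) * n), dampedMode s z ((l : ℝ) / n) := by
      rw [hS, ← Finset.Ico_insert_right hle, Finset.sum_insert (by simp)]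
      congr 2
      push_cast
      field_simp
    have h3 : ‖dampedMode s z w‖ ≤ 1 := by
      rw [norm_dampedMode, Real.exp_le_one_iff, neg_mul, neg_nonpos]
      positivity
    have hL : Real.pi ^ 2 * s + 1 + Real.pi * |z| ≤ (10 * T + 5 + 4 * R) * w := by
      have h4 : Real.pi ≤ 3.142 := Real.pi_lt_d4.le.trans (by norm_num)
      have h5 : Real.pi ^ 2 ≤ 10 := by nlinarith
      calc Real.pi ^ 2 * s + 1 + Real.pi * |z| ≤ 10 * T + 1 + 4 * (R + w) := by
            gcongr; linarith
        _ ≤ _ := by nlinarith [mul_nonneg hT (sub_nonneg.mpr hwR), mul_nonneg hR (sub_nonneg.mpr hwR)]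
    have hw5 : (w : ℝ) ^ 2 ≤ w ^ 5 := pow_le_pow_right₀ hwR (by norm_num)
    have hw51 : (1 : ℝ) ≤ w ^ 5 := one_le_pow₀ hwR
    rw [h2]
    have h6 : (1 / (2 * n) * (dampedMode s z w + ∑ l ∈ Finset.Ico (-((w : ℤ) * n)) ((w : ℤ) * n),
          dampedMode s z ((l : ℝ) / n)) - 1 / 2 * ∫ ξ in (-(w : ℝ))..w, dampedMode s z ξ : ℂ) =
        1 / (2 * n) * dampedMode s z w + 1 / 2 * (1 / n *
          ∑ l ∈ Finset.Ico (-((w : ℤ) * n)) ((w : ℤ) * n), dampedMode s z ((l : ℝ) / n) -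
          ∫ ξ in (-(w : ℝ))..w, dampedMode s z ξ) := by
      field_simp
      ring
    rw [h6]
    calc _ ≤ 1 / (2 * n) * 1 + 1 / 2 * ((10 * T + 5 + 4 * R) * w / n * (2 * w)) := by
          refine (norm_add_le _ _).trans ?_
          rw [norm_mul, norm_mul, hcoef]
          gcongr
          · simp
          · refine h1.trans (le_of_eq_of_le ?_ (mul_le_mul_of_nonneg_right
              (div_le_div_of_nonneg_right hL hnR.le) (by positivity)))
            congr 1
            field_simp
            ring
      _ = (1 / 2 + (10 * T + 5 + 4 * R) * w ^ 2) / n := by field_simp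
      _ ≤ (w ^ 5 + (10 * T + 5 + 4 * R) * w ^ 5) / n := by
          gcongr
          linarith
      _ = _ := by ring
  have hE3 : ‖1 / 2 * (∫ ξ in (-(w : ℝ))..w, dampedMode s z ξ) - heatKernel s z‖ ≤
      Real.sqrt (Real.pi / (Real.pi ^ 2 * c / 2)) *
        Real.exp (-(Real.pi ^ 2 * c / 2) * (w : ℝ) ^ 2) := by
    rw [← half_integral_dampedMode hs0, ← mul_sub, norm_mul]
    calc _ ≤ 1 * (Real.exp (-(Real.pi ^ 2 * s / 2) * (w : ℝ) ^ 2) *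
          Real.sqrt (Real.pi / (Real.pi ^ 2 * s / 2))) := by
          gcongr
          · norm_num
          · exact norm_integral_sub_integral_dampedMode_le hs0 z (by positivity)
      _ ≤ 1 * (Real.exp (-(Real.pi ^ 2 * c / 2) * (w : ℝ) ^ 2) *
          Real.sqrt (Real.pi / (Real.pi ^ 2 * c / 2))) := by gcongr
      _ = _ := by ring
  calc _ ≤ 900 * T * w ^ 5 / n + (10 * T + 6 + 4 * R) * w ^ 5 / n + _ :=
        (norm_sub_le_norm_sub_add_norm_sub _ _ _).trans (add_le_add
          ((norm_sub_le_norm_sub_add_norm_sub _ _ _).trans (add_le_add hE1 hE2)) hE3)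
    _ = _ := by ring

/-! ### Passage to the limit -/

lemma classicalSolution_eq_integral {g : ℝ → ℂ} {t : ℝ} (ht : 0 < t) (x : ℝ) :
    classicalSolution g t x = ∫ y, g y * heatKernel t (x - y) := by
  rw [classicalSolution, if_neg ht.ne', ← integral_const_mul]
  congr 1
  funext y
  rw [heatKernel]
  push_cast
  ring

lemma continuous_heatKernel (s : ℝ) : Continuous (heatKernel s) := by
  unfold heatKernel
  fun_prop

lemma tendsto_heatKernel {α : Type*} {l : Filter α} {s z : α → ℝ} {t y : ℝ} (ht : 0 < t)
    (hs : Tendsto s l (𝓝 t)) (hz : Tendsto z l (𝓝 y)) :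
    Tendsto (fun i => heatKernel (s i) (z i)) l (𝓝 (heatKernel t y)) := by
  unfold heatKernel
  have hπ := Real.pi_pos
  refine Tendsto.mul (Tendsto.div tendsto_const_nhds
    ((hs.const_mul _).sqrt) (by positivity)) ?_
  exact (Real.continuous_exp.tendsto _).comp ((hz.pow 2).neg.div (hs.const_mul 4) (by positivity))

lemma heatKernel_nonneg (s z : ℝ) : 0 ≤ heatKernel s z := by
  unfold heatKernel
  positivity

lemma heatKernel_le {s t : ℝ} (ht : 0 < t) (h1 : t / 2 ≤ s) (h2 : s ≤ 2 * t) (z : ℝ) :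
    heatKernel s z ≤ 1 / Real.sqrt (2 * Real.pi * t) * Real.exp (-z ^ 2 / (8 * t)) := by
  have hπ := Real.pi_pos
  have hs : 0 < s := by linarith
  unfold heatKernel
  gcongr ?_ * Real.exp ?_
  · apply one_div_le_one_div_of_le (by positivity)
    apply Real.sqrt_le_sqrt
    nlinarith
  · rw [neg_div, neg_div, neg_le_neg_iff]
    apply div_le_div_of_nonneg_left (by positivity) (by positivity)
    linarith

lemma tendsto_floor_mul_div {α : Type*} {l : Filter α} {n : α → ℕ} {x : α → ℝ} {y : ℝ}
    (hn : Tendsto n l atTop) (hx : Tendsto x l (𝓝 y)) :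
    Tendsto (fun i => (⌊(n i : ℝ) * x i⌋ : ℝ) / n i) l (𝓝 y) := by
  have h : Tendsto (fun i => (⌊(n i : ℝ) * x i⌋ : ℝ) / n i - x i) l (𝓝 0) := by
    refine squeeze_zero_norm' ?_ (tendsto_one_div_atTop_nhds_zero_nat.comp hn)
    filter_upwards [hn.eventually (eventually_gt_atTop 0)] with i hi
    exact abs_floor_mul_div_sub_le hi.ne' (x i)
  simpa using h.add hx

/-- The limit is taken jointly in independent parameters because dominated convergence needs a
countably generated filter, which an ultrafilter need not be. Families along an ultrafilter are then
handled by composition. -/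
lemma tendsto_riemannSum_heatKernel {g : ℝ → ℂ} (hg : Continuous g)
    (hgrowth : ∀ ε : ℝ, 0 < ε → ∃ C : ℝ, 0 ≤ C ∧ ∀ x, ‖g x‖ ≤ C * Real.exp (ε * x ^ 2))
    {t : ℝ} (ht : 0 < t) (x : ℝ) :
    Tendsto (fun p : ℕ × ℕ × ℝ × ℝ => 1 / (p.1 : ℂ) *
      ∑ j ∈ Finset.Ico (-((p.2.1 : ℤ) * p.1)) ((p.2.1 : ℤ) * p.1),
        g ((j : ℝ) / p.1) * heatKernel p.2.2.1 (p.2.2.2 - (j : ℝ) / p.1))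
      (atTop ×ˢ atTop ×ˢ 𝓝 t ×ˢ 𝓝 x) (𝓝 (classicalSolution g t x)) := by
  set l : Filter (ℕ × ℕ × ℝ × ℝ) := atTop ×ˢ atTop ×ˢ 𝓝 t ×ˢ 𝓝 x with hl
  have hn : Tendsto (fun p : ℕ × ℕ × ℝ × ℝ => p.1) l atTop := tendsto_fst
  have hω : Tendsto (fun p : ℕ × ℕ × ℝ × ℝ => p.2.1) l atTop := tendsto_fst.comp tendsto_snd
  have hs : Tendsto (fun p : ℕ × ℕ × ℝ × ℝ => p.2.2.1) l (𝓝 t) :=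
    tendsto_fst.comp (tendsto_snd.comp tendsto_snd)
  have hx : Tendsto (fun p : ℕ × ℕ × ℝ × ℝ => p.2.2.2) l (𝓝 x) :=
    tendsto_snd.comp (tendsto_snd.comp tendsto_snd)
  have hπ := Real.pi_pos
  -- For `s ≤ 2 t` the kernel decays at least like `exp (-z ^ 2 / (8 t))`; growth at a quarter of
  -- that rate leaves `exp (-y ^ 2 / (64 t))` after the shift by `x` and the rounding of `y`.
  obtain ⟨C, hC, hgC⟩ := hgrowth (1 / (32 * t)) (by positivity)
  set Φ : ℕ × ℕ × ℝ × ℝ → ℝ → ℂ := fun p => Set.indicator (Set.Ioc (-(p.2.1 : ℝ)) p.2.1)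
    (fun y => g ((⌊(p.1 : ℝ) * y⌋ : ℝ) / p.1) *
      heatKernel p.2.2.1 (p.2.2.2 - (⌊(p.1 : ℝ) * y⌋ : ℝ) / p.1)) with hΦ
  have hsum : ∀ᶠ p in l, ∫ y, Φ p y = 1 / (p.1 : ℂ) *
      ∑ j ∈ Finset.Ico (-((p.2.1 : ℤ) * p.1)) ((p.2.1 : ℤ) * p.1),
        g ((j : ℝ) / p.1) * heatKernel p.2.2.1 (p.2.2.2 - (j : ℝ) / p.1) := by
    filter_upwards [hn.eventually (eventually_gt_atTop 0)] with p hp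
    have hp' : (0 : ℝ) < p.1 := by exact_mod_cast hp
    have hle : -((p.2.1 : ℤ) * p.1) ≤ (p.2.1 : ℤ) * p.1 := by
      have : 0 ≤ (p.2.1 : ℤ) * p.1 := by positivity
      omega
    rw [← (stepFunction_integral hp.ne'
      (fun u => g u * heatKernel p.2.2.1 (p.2.2.2 - u)) hle).2, hΦ,
      integral_indicator measurableSet_Ioc]
    push_cast
    rw [neg_div, mul_div_cancel_right₀ _ hp'.ne', intervalIntegral.integral_of_le]
    have : (0 : ℝ) ≤ p.2.1 := by positivity
    linarith
  refine Tendsto.congr' hsum ?_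
  rw [classicalSolution_eq_integral ht]
  set R := |x| + 1 with hR
  set K := C * (1 / Real.sqrt (2 * Real.pi * t)) * Real.exp (R ^ 2 / (8 * t) + 1 / (32 * t)) with hK
  have hK0 : 0 ≤ K := by positivity
  refine tendsto_integral_filter_of_dominated_convergence
    (fun y => K * Real.exp (-(1 / (64 * t)) * y ^ 2)) ?_ ?_
    ((integrable_exp_neg_mul_sq (by positivity)).const_mul _) ?_
  · refine Eventually.of_forall fun p => (Measurable.indicator ?_ measurableSet_Ioc).aestronglyMeasurable
    have h1 : Measurable fun y : ℝ => (⌊(p.1 : ℝ) * y⌋ : ℝ) / p.1 := by fun_prop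
    have h2 : Continuous fun u : ℝ => g u * (heatKernel p.2.2.1 (p.2.2.2 - u) : ℂ) :=
      hg.mul (Complex.continuous_ofReal.comp ((continuous_heatKernel _).comp (by fun_prop)))
    exact h2.measurable.comp h1
  · filter_upwards [hn.eventually (eventually_gt_atTop 0),
      hs.eventually (Icc_mem_nhds (a := t / 2) (b := 2 * t) (by linarith) (by linarith)),
      hx.abs.eventually (ge_mem_nhds (show |x| < R by linarith))] with p hp hps hpx
    refine Eventually.of_forall fun y => ?_
    by_cases hy : y ∈ Set.Ioc (-(p.2.1 : ℝ)) p.2.1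
    · rw [hΦ]
      beta_reduce
      rw [Set.indicator_of_mem hy]
      set u := (⌊(p.1 : ℝ) * y⌋ : ℝ) / p.1 with hu
      have hp1 : (1 : ℝ) ≤ p.1 := by exact_mod_cast hp
      have huy : |u - y| ≤ 1 := (abs_floor_mul_div_sub_le hp.ne' y).trans
        (by rw [div_le_one (by linarith)]; exact hp1)
      have huy2 : (u - y) ^ 2 ≤ 1 := by rw [← sq_abs]; nlinarith [abs_nonneg (u - y)]
      have hx2 : p.2.2.2 ^ 2 ≤ R ^ 2 := by
        rw [← sq_abs p.2.2.2]; gcongr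
      rw [norm_mul, Complex.norm_real, Real.norm_eq_abs, abs_of_nonneg (heatKernel_nonneg _ _)]
      calc _ ≤ C * Real.exp (1 / (32 * t) * u ^ 2) * (1 / Real.sqrt (2 * Real.pi * t) *
            Real.exp (-(p.2.2.2 - u) ^ 2 / (8 * t))) :=
            mul_le_mul (hgC u) (heatKernel_le ht hps.1 hps.2 _) (heatKernel_nonneg _ _) (by positivity)
        _ = C * (1 / Real.sqrt (2 * Real.pi * t)) *
            Real.exp (1 / (32 * t) * u ^ 2 + -(p.2.2.2 - u) ^ 2 / (8 * t)) := by
            rw [Real.exp_add]; ring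
        _ ≤ C * (1 / Real.sqrt (2 * Real.pi * t)) *
            Real.exp ((R ^ 2 / (8 * t) + 1 / (32 * t)) + -(1 / (64 * t)) * y ^ 2) := by
            refine mul_le_mul_of_nonneg_left (Real.exp_le_exp.mpr ?_) (by positivity)
            have e1 : 1 / (32 * t) * u ^ 2 + -(p.2.2.2 - u) ^ 2 / (8 * t) =
              (2 * u ^ 2 - 8 * (p.2.2.2 - u) ^ 2) / (64 * t) := by field_simp; ring
            have e2 : (R ^ 2 / (8 * t) + 1 / (32 * t)) + -(1 / (64 * t)) * y ^ 2 =
              (8 * R ^ 2 + 2 - y ^ 2) / (64 * t) := by field_simp; ring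
            rw [e1, e2]
            refine div_le_div_of_nonneg_right ?_ (by positivity)
            -- The first square bounds the left side by `8 x ^ 2 - 2 u ^ 2`; the second gives `y ^ 2
            -- ≤ 2 u ^ 2 + 2 (u - y) ^ 2`.
            nlinarith [sq_nonneg (2 * p.2.2.2 - u), sq_nonneg (2 * u - y)]
        _ = _ := by rw [Real.exp_add, hK]; ring
    · rw [hΦ]
      beta_reduce
      rw [Set.indicator_of_notMem hy, norm_zero]
      positivity
  · refine Eventually.of_forall fun y => ?_
    have hu : Tendsto (fun p : ℕ × ℕ × ℝ × ℝ => (⌊(p.1 : ℝ) * y⌋ : ℝ) / p.1) l (𝓝 y) :=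
      tendsto_floor_mul_div hn tendsto_const_nhds
    have hmain : Tendsto (fun p : ℕ × ℕ × ℝ × ℝ => g ((⌊(p.1 : ℝ) * y⌋ : ℝ) / p.1) *
        (heatKernel p.2.2.1 (p.2.2.2 - (⌊(p.1 : ℝ) * y⌋ : ℝ) / p.1) : ℂ)) l
        (𝓝 (g y * heatKernel t (x - y))) :=
      ((hg.tendsto y).comp hu).mul
        ((Complex.continuous_ofReal.tendsto _).comp (tendsto_heatKernel ht hs (hx.sub hu)))
    refine hmain.congr' ?_
    filter_upwards [(tendsto_natCast_atTop_atTop (R := ℝ)).comp hω |>.eventually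
      (eventually_gt_atTop |y|)] with p hp
    rw [hΦ]
    beta_reduce
    have : -(p.2.1 : ℝ) < y ∧ y < p.2.1 := abs_lt.mp hp
    rw [Set.indicator_of_mem (Set.mem_Ioc.mpr ⟨this.1, this.2.le⟩)]

lemma tendsto_pow_mul_exp_sub_mul_sq (k : ℕ) {a : ℝ} (ha : 0 < a) :
    Tendsto (fun x : ℝ => x ^ k * Real.exp (x - a * x ^ 2)) atTop (𝓝 0) := by
  refine squeeze_zero' ?_ ?_ (Real.tendsto_pow_mul_exp_neg_atTop_nhds_zero k)
  · filter_upwards [eventually_ge_atTop 0] with x hx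
    positivity
  · filter_upwards [eventually_ge_atTop (2 / a), eventually_ge_atTop 0] with x hx hx0
    gcongr
    rw [div_le_iff₀ ha] at hx
    nlinarith

/-- The `2 ω n` terms, weighted by `1 / n`, turn a kernel error `E` into at most `2 C ω exp(w) E`.
Since `n ≥ exp (w ^ 2)`, both parts of `E` decay like a Gaussian in `w`, up to a power, and beat
`exp w`. -/
lemma tendsto_sum_discreteKernel {α : Type*} {l : Filter α} {g : ℝ → ℂ} (hg : Continuous g)
    (hgrowth : ∀ ε : ℝ, 0 < ε → ∃ C : ℝ, 0 ≤ C ∧ ∀ x, ‖g x‖ ≤ C * Real.exp (ε * x ^ 2))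
    {t x : ℝ} (ht : 0 < t) {n ω w k : α → ℕ} {m : α → ℤ} (hn : Tendsto n l atTop)
    (hω : Tendsto ω l atTop) (hw : Tendsto w l atTop)
    (hk : Tendsto (fun i => (k i : ℝ) / n i) l (𝓝 t))
    (hm : Tendsto (fun i => (m i : ℝ) / n i) l (𝓝 x))
    (hωw : ∀ᶠ i in l, (ω i : ℝ) ^ 2 ≤ w i) (hwn : ∀ᶠ i in l, Real.exp ((w i : ℝ) ^ 2) ≤ n i) :
    Tendsto (fun i => 1 / (n i : ℂ) * ∑ j ∈ Finset.Ico (-((ω i : ℤ) * n i)) ((ω i : ℤ) * n i),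
      g ((j : ℝ) / n i) * discreteKernel (n i) (w i) (k i) (((m i - j : ℤ) : ℝ) / n i)) l
      (𝓝 (classicalSolution g t x)) := by
  have hmain := (tendsto_riemannSum_heatKernel hg hgrowth ht x).comp
    (hn.prodMk (hω.prodMk (hk.prodMk hm)))
  obtain ⟨C, hC, hgC⟩ := hgrowth 1 one_pos
  obtain ⟨P, D, a, hP, hD, ha, hker⟩ := exists_norm_discreteKernel_sub_le (c := t / 2) (T := 2 * t)
    (R := |x| + 1) (by positivity) (by positivity) (by positivity)
  have hwR : Tendsto (fun i => (w i : ℝ)) l atTop := tendsto_natCast_atTop_atTop.comp hw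
  have herr : Tendsto (fun i => 2 * C * (P * ((w i : ℝ) ^ 6 * Real.exp (w i - 1 * (w i : ℝ) ^ 2)) +
      D * ((w i : ℝ) ^ 1 * Real.exp (w i - a * (w i : ℝ) ^ 2)))) l (𝓝 0) := by
    have h1 := (tendsto_pow_mul_exp_sub_mul_sq 6 one_pos).comp hwR
    have h2 := (tendsto_pow_mul_exp_sub_mul_sq 1 ha).comp hwR
    simpa using ((h1.const_mul P).add (h2.const_mul D)).const_mul (2 * C)
  -- This provides both size conditions of the kernel estimate, `10 w ^ 2 ≤ n` and `200 T w ^ 4 ≤ n`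
  -- with `T = 2 t`.
  have hlarge : ∀ᶠ i in l, (400 * t + 10) * (w i : ℝ) ^ 4 ≤ n i := by
    have h1 := ((tendsto_pow_mul_exp_sub_mul_sq 4 one_pos).comp hwR).eventually
      (ge_mem_nhds (show 0 < 1 / (400 * t + 10) by positivity))
    filter_upwards [h1, hwn] with i hi hi'
    refine le_trans ?_ hi'
    simp only [Function.comp, one_mul] at hi
    rw [le_div_iff₀ (by positivity), Real.exp_sub] at hi
    have h2 : 1 ≤ Real.exp (w i : ℝ) := Real.one_le_exp (by positivity)
    have h3 := Real.exp_pos ((w i : ℝ) ^ 2)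
    rw [mul_div_assoc', div_mul_eq_mul_div, div_le_one h3] at hi
    refine le_trans ?_ hi
    nlinarith [mul_nonneg (by positivity : 0 ≤ (w i : ℝ) ^ 4 * (400 * t + 10)) (sub_nonneg.mpr h2)]
  rw [← sub_zero (classicalSolution g t x)]
  refine Tendsto.congr (fun i => sub_sub_cancel _ _) (hmain.sub (squeeze_zero_norm' ?_ herr))
  filter_upwards [hwn, hωw, hlarge, hn.eventually (eventually_gt_atTop 0),
    hw.eventually (eventually_ge_atTop 1),
    hk.eventually (Icc_mem_nhds (a := t / 2) (b := 2 * t) (by linarith) (by linarith)),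
    hm.abs.eventually (ge_mem_nhds (show |x| < |x| + 1 by linarith))]
    with i hwn hωw hlarge hn hw hk hm
  have hnR : (0 : ℝ) < n i := by exact_mod_cast hn
  have hwR : (1 : ℝ) ≤ w i := by exact_mod_cast hw
  have hw4 : (w i : ℝ) ^ 2 ≤ (w i : ℝ) ^ 4 := pow_le_pow_right₀ hwR (by norm_num)
  have hωle : (ω i : ℝ) ≤ w i := by
    have : ((ω i : ℕ) : ℝ) ≤ (ω i : ℝ) ^ 2 := by exact_mod_cast Nat.le_self_pow two_ne_zero _
    linarith
  set E := P * (w i : ℝ) ^ 5 / n i + D * Real.exp (-a * (w i : ℝ) ^ 2) with hE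
  have hE0 : 0 ≤ E := by positivity
  have hterm : ∀ j ∈ Finset.Ico (-((ω i : ℤ) * n i)) ((ω i : ℤ) * n i),
      ‖g ((j : ℝ) / n i) * heatKernel ((k i : ℝ) / n i) ((m i : ℝ) / n i - (j : ℝ) / n i) -
        g ((j : ℝ) / n i) * discreteKernel (n i) (w i) (k i) (((m i - j : ℤ) : ℝ) / n i)‖ ≤
      C * Real.exp (w i) * E := by
    intro j hj
    rw [Finset.mem_Ico] at hj
    have hjω : |(j : ℝ) / n i| ≤ ω i := by
      rw [abs_div, abs_of_pos hnR, div_le_iff₀ hnR]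
      have : |j| ≤ (ω i : ℤ) * n i := abs_le.mpr ⟨hj.1, hj.2.le⟩
      exact_mod_cast this
    have hz : ((m i - j : ℤ) : ℝ) / n i = (m i : ℝ) / n i - (j : ℝ) / n i := by
      push_cast; rw [sub_div]
    rw [← mul_sub, norm_mul, norm_sub_rev, hz]
    gcongr
    · refine (hgC _).trans ?_
      gcongr
      rw [one_mul]
      refine le_trans ?_ hωw
      rw [← sq_abs]
      gcongr
    · refine hker _ _ _ _ hw ?_ ?_ hk.1 hk.2 ?_
      · have : 10 * (w i : ℝ) ^ 2 ≤ n i := by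
          have : 0 ≤ 400 * t * (w i : ℝ) ^ 4 := by positivity
          linarith
        exact_mod_cast this
      · have : 0 ≤ (w i : ℝ) ^ 4 := by positivity
        linarith
      · exact (abs_sub _ _).trans (add_le_add hm (hjω.trans hωle))
  simp only [Function.comp]
  rw [← mul_sub, ← Finset.sum_sub_distrib, norm_mul, norm_div, norm_one, Complex.norm_natCast]
  have hcard : ((Finset.Ico (-((ω i : ℤ) * n i)) ((ω i : ℤ) * n i)).card : ℝ) = 2 * ω i * n i := by
    rw [Int.card_Ico]
    have : ((ω i : ℤ) * n i - -((ω i : ℤ) * n i)).toNat = 2 * ω i * n i := by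
      zify
      have : 0 ≤ (ω i : ℤ) * n i := by positivity
      rw [Int.toNat_of_nonneg (by omega)]
      ring
    rw [this]; push_cast; ring
  calc _ ≤ 1 / (n i : ℝ) * (2 * ω i * n i * (C * Real.exp (w i) * E)) := by
        gcongr
        refine (norm_sum_le_of_le _ hterm).trans ?_
        rw [Finset.sum_const, nsmul_eq_mul, hcard]
    _ = 2 * C * (ω i * Real.exp (w i) * E) := by field_simp
    _ ≤ 2 * C * (w i * Real.exp (w i) *
        (P * (w i : ℝ) ^ 5 * Real.exp (-(w i : ℝ) ^ 2) + D * Real.exp (-a * (w i : ℝ) ^ 2))) := by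
        gcongr
        rw [hE, div_eq_mul_inv, Real.exp_neg]
        gcongr
    _ = _ := by
        rw [sub_eq_add_neg, sub_eq_add_neg, Real.exp_add, Real.exp_add, one_mul, neg_mul]
        ring

/-! ### Transfer between the ultrapower and its indices -/

lemma tendsto_of_mem_infiniteNat {ι : Type*} {𝒰 : Ultrafilter ι} {n : ι → ℕ}
    (h : ((n : Germ (𝒰 : Filter ι) ℕ) : Ext 𝒰 ℕ) ∈ infiniteNat 𝒰) : Tendsto n 𝒰 atTop := by
  rw [tendsto_atTop]
  intro b
  have h1 : ∀ k : ℕ, ∀ᶠ i in (𝒰 : Filter ι), n i ≠ k := by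
    intro k
    have h2 : ¬ ∀ᶠ i in (𝒰 : Filter ι), n i = k := fun h' => h k (Germ.coe_eq.mpr h')
    exact Ultrafilter.eventually_not.mpr h2
  have h3 : ∀ᶠ i in (𝒰 : Filter ι), ∀ k ∈ Finset.range b, n i ≠ k :=
    (Filter.eventually_all_finset _).mpr fun k _ => h1 k
  filter_upwards [h3] with i hi
  by_contra hlt
  exact hi (n i) (Finset.mem_range.mpr (not_le.mp hlt)) rfl

lemma tendsto_of_st_eq {ι : Type*} {𝒰 : Ultrafilter ι} {x : ι → ℝ} {r : ℝ}
    (h : st ((x : Germ (𝒰 : Filter ι) ℝ) : Ext 𝒰 ℝ) = (r : EReal)) : Tendsto x 𝒰 (𝓝 r) := by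
  rw [tendsto_order]
  constructor
  · intro a ha
    have h1 : (a : EReal) < st ((x : Germ (𝒰 : Filter ι) ℝ) : Ext 𝒰 ℝ) := by
      rw [h]; exact_mod_cast ha
    obtain ⟨⟨b, hb⟩, hab⟩ := lt_iSup_iff.mp h1
    have hb' : ∀ᶠ i in (𝒰 : Filter ι), b ≤ x i := Germ.coe_le.mp hb
    filter_upwards [hb'] with i hi
    exact (EReal.coe_lt_coe_iff.mp hab).trans_le hi
  · intro a ha
    by_contra hcon
    have h1 : ∀ᶠ i in (𝒰 : Filter ι), a ≤ x i := by
      filter_upwards [Ultrafilter.eventually_not.mpr hcon] with i hi using not_lt.mp hi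
    have h2 : (a : EReal) ≤ st ((x : Germ (𝒰 : Filter ι) ℝ) : Ext 𝒰 ℝ) :=
      le_iSup (fun r : {r : ℝ // (r : Germ (𝒰 : Filter ι) ℝ) ≤
        ((x : Germ (𝒰 : Filter ι) ℝ))} => ((r : ℝ) : EReal)) ⟨a, Germ.coe_le.mpr h1⟩
    rw [h] at h2
    exact absurd (EReal.coe_le_coe_iff.mp h2) (not_le.mpr ha)

/-- Transfer of the heat equation to almost all indices. -/
lemma eventually_heat_eq {ι : Type*} {𝒰 : Ultrafilter ι} {n : ι → ℕ} {f : ι → ℝ → ℝ → ℂ}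
    (h : ∀ t ∈ timeDomain ((n : Germ (𝒰 : Filter ι) ℕ) : Ext 𝒰 ℕ),
      t < (toReal ((n : Germ (𝒰 : Filter ι) ℕ) : Ext 𝒰 ℕ) ^ 2 - 1) /
        toReal ((n : Germ (𝒰 : Filter ι) ℕ) : Ext 𝒰 ℕ) →
      ∀ x ∈ spaceDomain ((n : Germ (𝒰 : Filter ι) ℕ) : Ext 𝒰 ℕ),
        app₂ (dt (n : Germ (𝒰 : Filter ι) ℕ) (f : Germ (𝒰 : Filter ι) (ℝ → ℝ → ℂ))) t x -
        app₂ (dx (n : Germ (𝒰 : Filter ι) ℕ) (dx (n : Germ (𝒰 : Filter ι) ℕ)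
          (f : Germ (𝒰 : Filter ι) (ℝ → ℝ → ℂ)))) t x = 0) :
    ∀ᶠ i in (𝒰 : Filter ι), ∀ t x : ℝ, 0 ≤ t → t < n i → t < ((n i : ℝ) ^ 2 - 1) / n i →
      -(n i : ℝ) ≤ x → x < n i →
      discreteDt (n i) (f i) t x - discreteDx (n i) (discreteDx (n i) (f i)) t x = 0 := by
  -- If the equation failed at almost all indices, points of failure chosen index by index would
  -- define hyperreals `t` and `x` violating the internal equation.
  by_contra hcon
  have h1 := Ultrafilter.eventually_not.mpr hcon
  push Not at h1
  obtain ⟨t, ht⟩ := h1.choice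
  obtain ⟨x, hx⟩ := ht.choice
  have e1 : ((t : Germ (𝒰 : Filter ι) ℝ) : Ext 𝒰 ℝ) ∈
      timeDomain ((n : Germ (𝒰 : Filter ι) ℕ) : Ext 𝒰 ℕ) :=
    ⟨Germ.coe_le.mpr (hx.mono fun i hi => hi.1), Germ.coe_lt.mpr (hx.mono fun i hi => hi.2.1)⟩
  have e2 : ((x : Germ (𝒰 : Filter ι) ℝ) : Ext 𝒰 ℝ) ∈
      spaceDomain ((n : Germ (𝒰 : Filter ι) ℕ) : Ext 𝒰 ℕ) :=
    ⟨Germ.coe_le.mpr (hx.mono fun i hi => hi.2.2.2.1),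
      Germ.coe_lt.mpr (hx.mono fun i hi => hi.2.2.2.2.1)⟩
  have h2 := h _ e1 (Germ.coe_lt.mpr (hx.mono fun i hi => hi.2.2.1)) _ e2
  have h3 : ∀ᶠ i in (𝒰 : Filter ι), discreteDt (n i) (f i) (t i) (x i) -
      discreteDx (n i) (discreteDx (n i) (f i)) (t i) (x i) = 0 := Germ.coe_eq.mp h2
  obtain ⟨i, hi1, hi2⟩ := (h3.and hx).exists
  exact hi2.2.2.2.2.2 hi1

lemma eventually_boundary {ι : Type*} {𝒰 : Ultrafilter ι} {n : ι → ℕ} {b : ι → ℝ → ℂ}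
    {f : ι → ℝ → ℝ → ℂ}
    (h : ∀ x ∈ spaceDomain ((n : Germ (𝒰 : Filter ι) ℕ) : Ext 𝒰 ℕ),
      app₂ (f : Germ (𝒰 : Filter ι) (ℝ → ℝ → ℂ)) 0 x = app (b : Germ (𝒰 : Filter ι) (ℝ → ℂ)) x) :
    ∀ᶠ i in (𝒰 : Filter ι), ∀ x : ℝ, -(n i : ℝ) ≤ x → x < n i → f i 0 x = b i x := by
  by_contra hcon
  have h1 := Ultrafilter.eventually_not.mpr hcon
  push Not at h1
  obtain ⟨x, hx⟩ := h1.choice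
  have h2 := h (x : Germ (𝒰 : Filter ι) ℝ) ⟨Germ.coe_le.mpr (hx.mono fun i hi => hi.1),
    Germ.coe_lt.mpr (hx.mono fun i hi => hi.2.1)⟩
  have h3 : ∀ᶠ i in (𝒰 : Filter ι), f i 0 (x i) = b i (x i) := Germ.coe_eq.mp h2
  obtain ⟨i, hi1, hi2⟩ := (h3.and hx).exists
  exact hi2.2.2 hi1

/-- The smoothed solution at a standard level, expressed through the initial data. -/
lemma discreteConv_heatSolution {n w ω : ℕ} {g : ℝ → ℂ} {f : ℝ → ℝ → ℂ}
    (hw : w < n) (hmeas : IsDiscreteMeasurable n f)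
    (heat : ∀ t x : ℝ, 0 ≤ t → t < n → t < ((n : ℝ) ^ 2 - 1) / n → -(n : ℝ) ≤ x → x < n →
      discreteDt n f t x - discreteDx n (discreteDx n f) t x = 0)
    (h0 : ∀ x : ℝ, -(n : ℝ) ≤ x → x < n → f 0 x = discreteTruncation g n ω x)
    {t : ℝ} (ht0 : 0 ≤ t) (htω : ω + 2 * t + 1 ≤ n) (x : ℝ) :
    discreteConv n (discreteInvFourier n (discreteCutoff n w)) f t x =
      1 / n * ∑ j ∈ Finset.Ico (-((ω : ℤ) * n)) ((ω : ℤ) * n), g ((j : ℝ) / n) *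
        discreteKernel n w ⌊(n : ℝ) * t⌋₊ (((⌊(n : ℝ) * x⌋ - j : ℤ) : ℝ) / n) := by
  have hn : n ≠ 0 := by omega
  have hnR : (0 : ℝ) < n := by positivity
  have hn1 : (1 : ℝ) ≤ n := by exact_mod_cast Nat.one_le_iff_ne_zero.mpr hn
  set k := ⌊(n : ℝ) * t⌋₊ with hk
  have hkt : (k : ℝ) ≤ n * t := Nat.floor_le (by positivity)
  -- The term `2 * k` leaves room for the spread to the left; the `1` makes the data vanish in the
  -- last space cell.
  have hkM : (ω : ℤ) * n + 2 * k + 1 ≤ (n : ℤ) ^ 2 := by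
    have : (ω : ℝ) * n + 2 * k + 1 ≤ (n : ℝ) ^ 2 := by nlinarith
    exact_mod_cast this
  have hω0 : 0 ≤ (ω : ℤ) * n := by positivity
  set u : ℤ → ℂ := fun j => if -((ω : ℤ) * n) ≤ j ∧ j < (ω : ℤ) * n then g ((j : ℝ) / n) else 0
    with hu
  have hrange : ∀ j : ℤ, -(n : ℤ) ^ 2 ≤ j → j < (n : ℤ) ^ 2 →
      -(n : ℝ) ≤ (j : ℝ) / n ∧ (j : ℝ) / n < n := by
    intro j h1 h2
    have h1' : -(n : ℝ) ^ 2 ≤ j := by exact_mod_cast h1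
    have h2' : (j : ℝ) < (n : ℝ) ^ 2 := by exact_mod_cast h2
    rw [le_div_iff₀ hnR, div_lt_iff₀ hnR]
    constructor <;> nlinarith
  have hgrid := heatSolution_grid hn (f := f) (u := u) (M := (ω : ℤ) * n)
    (fun k' hk' j h1 h2 => by
      have hk'' : (k' : ℝ) ≤ (n : ℝ) ^ 2 - 2 := by exact_mod_cast hk'
      have h3 : (k' : ℝ) / n < ((n : ℝ) ^ 2 - 1) / n := by gcongr; linarith
      refine heat _ _ (by positivity) (h3.trans_le ?_) h3 (hrange j h1 h2).1 (hrange j h1 h2).2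
      rw [div_le_iff₀ hnR]
      nlinarith)
    (fun j h1 h2 => by
      rw [h0 _ (hrange j h1 h2).1 (hrange j h1 h2).2, discreteTruncation, floor_mul_div hn, hu]
      refine if_congr ?_ rfl rfl
      rw [le_div_iff₀ hnR, div_lt_iff₀ hnR, neg_mul]
      exact_mod_cast Iff.rfl)
    (fun j hj => if_neg (by omega)) (by omega) k (by omega)
  have hcell : ∀ j : ℤ, -(n : ℤ) ^ 2 ≤ j → j < (n : ℤ) ^ 2 →
      f t ((j : ℝ) / n) = explicitScheme n u k j := by
    intro j h1 h2
    have hω' : (0 : ℝ) ≤ ω := by positivity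
    rw [hmeas.eq_floor hn (t := t) ⟨ht0, by linarith⟩ (hrange j h1 h2), ← hgrid j h1 h2, hk,
      natCast_floor_eq_intCast_floor (by positivity)]
  rw [discreteConv_eq_sum (M := (ω : ℤ) * n) hw hcell (fun j hj => if_neg (by omega)) (fun j hj => if_neg (by omega))
    (by omega) x]
  congr 1
  refine Finset.sum_congr rfl fun j hj => ?_
  rw [hu]
  beta_reduce
  rw [if_pos (Finset.mem_Ico.mp hj)]

end NSHeat

theorem mainTheorem2 {ι : Type*} (𝒰 : Ultrafilter ι) (g : ℝ → ℂ) (hg : Continuous g)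
    (hgrowth : ∃ A B ρ : ℝ, ρ < 2 ∧ ∀ x : ℝ, ‖g x‖ ≤ A * Real.exp (B * |x| ^ ρ))
    (η ω ω' : NSHeat.Ext 𝒰 ℕ)
    (hη : η ∈ NSHeat.infiniteNat 𝒰) (hω : ω ∈ NSHeat.infiniteNat 𝒰)
    (hω' : ω' ∈ NSHeat.infiniteNat 𝒰)
    (hηω : ∀ r : ℝ, (r : Filter.Germ (𝒰 : Filter ι) ℝ) < NSHeat.toReal η - NSHeat.toReal ω)
    (hωω' : NSHeat.toReal ω < Filter.Germ.map Real.sqrt (NSHeat.toReal ω'))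
    (hω'η : NSHeat.toReal ω' <
      Filter.Germ.map Real.sqrt (Filter.Germ.map Real.log (NSHeat.toReal η)))
    (f : NSHeat.Ext 𝒰 (ℝ → ℝ → ℂ))
    (hf : NSHeat.IsHeatSolution η (NSHeat.truncation g η ω) f) :
    ∀ t ∈ NSHeat.timeDomain η, ∀ x ∈ NSHeat.spaceDomain η,
      (∃ s : ℝ, 0 < s ∧ NSHeat.st t = (s : EReal)) → (∃ y : ℝ, NSHeat.st x = (y : EReal)) →
      NSHeat.HasStdPart
        (NSHeat.app₂ (NSHeat.conv η (NSHeat.invFourier η (NSHeat.cutoff η ω')) f) t x)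
        (NSHeat.extendedSolution g (NSHeat.st t) (NSHeat.st x)) := by
  induction η using Filter.Germ.inductionOn with | _ n
  induction ω using Filter.Germ.inductionOn with | _ o
  induction ω' using Filter.Germ.inductionOn with | _ w
  induction f using Filter.Germ.inductionOn with | _ f
  intro t ht x hx
  induction t using Filter.Germ.inductionOn with | _ t
  induction x using Filter.Germ.inductionOn with | _ x
  rintro ⟨s, hs, hst⟩ ⟨y, hxy⟩
  have hn := NSHeat.tendsto_of_mem_infiniteNat hη
  have ho := NSHeat.tendsto_of_mem_infiniteNat hω
  have hw := NSHeat.tendsto_of_mem_infiniteNat hω'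
  have htt := NSHeat.tendsto_of_st_eq hst
  have htx := NSHeat.tendsto_of_st_eq hxy
  have hmeas : ∀ᶠ i in (𝒰 : Filter ι), NSHeat.IsDiscreteMeasurable (n i) (f i) := hf.measurable
  have heat := NSHeat.eventually_heat_eq hf.heat_eq
  have hbd : ∀ᶠ i in (𝒰 : Filter ι), ∀ x : ℝ, -(n i : ℝ) ≤ x → x < n i →
      f i 0 x = NSHeat.discreteTruncation g (n i) (o i) x := NSHeat.eventually_boundary hf.boundary
  -- Eventually `t i ≤ s + 1`, so this margin gives the `ω + 2 * t + 1 ≤ n` required by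
  -- `discreteConv_heatSolution`.
  have hsep : ∀ᶠ i in (𝒰 : Filter ι), 2 * (s + 1) + 1 < (n i : ℝ) - o i :=
    Filter.Germ.coe_lt.mp (hηω (2 * (s + 1) + 1))
  have how : ∀ᶠ i in (𝒰 : Filter ι), (o i : ℝ) < Real.sqrt (w i) := Filter.Germ.coe_lt.mp hωω'
  have hwn : ∀ᶠ i in (𝒰 : Filter ι), (w i : ℝ) < Real.sqrt (Real.log (n i)) :=
    Filter.Germ.coe_lt.mp hω'η
  have how' : ∀ᶠ i in (𝒰 : Filter ι), (o i : ℝ) ^ 2 ≤ w i := by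
    filter_upwards [how] with i hi
    exact ((Real.lt_sqrt (by positivity)).mp hi).le
  have hwn' : ∀ᶠ i in (𝒰 : Filter ι), Real.exp ((w i : ℝ) ^ 2) ≤ n i := by
    filter_upwards [hwn, hn.eventually (eventually_gt_atTop 0)] with i hi hni
    exact (Real.le_log_iff_exp_le (by exact_mod_cast hni)).mp
      ((Real.lt_sqrt (by positivity)).mp hi).le
  have ht0 : ∀ᶠ i in (𝒰 : Filter ι), 0 ≤ t i := Filter.Germ.coe_le.mp ht.1
  have hfloor := NSHeat.tendsto_floor_mul_div hn htx
  have hfloor' : Tendsto (fun i => (⌊(n i : ℝ) * t i⌋₊ : ℝ) / n i) 𝒰 (𝓝 s) := by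
    refine (NSHeat.tendsto_floor_mul_div hn htt).congr' ?_
    filter_upwards [ht0] with i hi
    rw [natCast_floor_eq_intCast_floor (by positivity)]
  have hlim := NSHeat.tendsto_sum_discreteKernel hg
    (fun ε hε => NSHeat.exists_norm_le_exp_sq hg hgrowth hε) hs hn ho hw hfloor' hfloor how' hwn'
  rw [hst, hxy, NSHeat.extendedSolution, if_neg (by simp), EReal.toReal_coe, EReal.toReal_coe]
  refine Tendsto.congr' ?_ hlim
  filter_upwards [hmeas, heat, hbd, hsep, hwn', ht0,
    htt.eventually (ge_mem_nhds (show s < s + 1 by linarith))] with i h1 h2 h3 h4 h5 h6 h7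
  have hwlt : w i < n i := by
    have e1 : (w i : ℝ) ≤ (w i : ℝ) ^ 2 := by exact_mod_cast Nat.le_self_pow two_ne_zero _
    have e2 := Real.add_one_le_exp ((w i : ℝ) ^ 2)
    have : (w i : ℝ) < n i := by linarith
    exact_mod_cast this
  exact (NSHeat.discreteConv_heatSolution hwlt h1 h2 h3 h6 (by linarith) (x i)).symm
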